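/- Let $K\subset\mathbb{R}^2$ be a convex body (a compact convex set with non-empty interior) with $o\in\operatorname{int}K$, let $K^*=\{x\in\mathbb{R}^2:\ \langle x,y\rangle\le 1\ \text{for all } y\in K\}$ be its polar body, let $|\cdot|$ denote area, and suppose that for some $\varepsilon>0$ $$|K|\cdot|K^*|\le(1+\varepsilon)\cdot\frac{27}{4}.$$ For planar convex bodies $K,L$ the Banach–Mazur distance $\delta_{BM}(K,L)$ is the minimum of the ratios $\lambda_2/\lambda_1$ over all $\lambda_1,\lambda_2>0$ for which there are a non-singular affinity $A$ of the plane and a vector $x$ with $\lambda_1A(K)\subset L\subset\lambda_2A(K)+x$. (1) For every (non-degenerate) triangle $T$ we have $\delta_{BM}(K,T)\le 1+900\,\varepsilon$. (2) Moreover, let $x\in\mathbb{R}^2$, let $\lambda_1,\lambda_2>0$, and let $T$ be a triangle such that $$\lambda_1T+x\subset K\subset\lambda_2T+x\qquad\text{and}\qquad \frac{\lambda_2}{\lambda_1}\le 1+900\,\varepsilon<4.$$ Then, in the Euclidean norm (the norm given by a positive definite quadratic form) for which $\frac{\lambda_1+\lambda_2}{2}T$ is a regular triangle of side $1$, the distance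 from $o$ of the centre (centroid) of the triangle $\frac{\lambda_1+\lambda_2}{2}T+x$ is at most $917\sqrt{\varepsilon}$. -/

import Mathlib

open MeasureTheory
open scoped Pointwise

/-- The Euclidean plane. -/
abbrev Plane : Type := EuclideanSpace ℝ (Fin 2)

/-- The polar `{x | ⟨x, y⟩ ≤ 1 for all y ∈ K}` of a set `K` with respect to the unit circle with
centre at the origin. -/
def polarBody (K : Set Plane) : Set Plane :=
  {x | ∀ y ∈ K, inner ℝ x y ≤ 1}

/-- The ratios `lam₂ / lam₁`, with `lam₁, lam₂ > 0`, for which there are a (non-singular) affinity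
`A` of the plane and a vector `x` such that `lam₁ A(K) ⊆ L ⊆ lam₂ A(K) + x`. -/
def banachMazurRatios (K L : Set Plane) : Set ℝ :=
  {r | ∃ lam₁ lam₂ : ℝ, 0 < lam₁ ∧ 0 < lam₂ ∧ ∃ (A : Plane ≃ᵃ[ℝ] Plane) (x : Plane),
    lam₁ • (A '' K) ⊆ L ∧ L ⊆ lam₂ • (A '' K) + {x} ∧ r = lam₂ / lam₁}

/-- The Banach–Mazur distance of two planar convex bodies: the least element of
`banachMazurRatios K L`. It is attained, see `banachMazurDist_isLeast`. -/
noncomputable def banachMazurDist (K L : Set Plane) : ℝ :=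
  sInf (banachMazurRatios K L)

/-- A Euclidean norm on the plane: the square root of a positive definite quadratic form. -/
def IsEuclideanNorm (N : Plane → ℝ) : Prop :=
  ∃ Q : QuadraticForm ℝ Plane, Q.PosDef ∧ ∀ v, N v = √(Q v)

/-- `N` is the Euclidean norm in which the triangle with vertices `p 0, p 1, p 2` is a regular
triangle of side `1`. -/
def IsUnitRegularNorm (p : Fin 3 → Plane) (N : Plane → ℝ) : Prop :=
  IsEuclideanNorm N ∧ ∀ i j, i ≠ j → N (p i - p j) = 1

theorem banachMazurRatios_nonempty {K L : Set Plane} (hK : IsCompact K) (hL : IsCompact L)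
    (hK' : (interior K).Nonempty) (hL' : (interior L).Nonempty) :
    (banachMazurRatios K L).Nonempty := by
  obtain ⟨k, hk⟩ := hK'
  obtain ⟨l, hl⟩ := hL'
  obtain ⟨ρ, hρ, hkρ⟩ := Metric.isOpen_iff.1 isOpen_interior k hk
  obtain ⟨σ, hσ, hlσ⟩ := Metric.isOpen_iff.1 isOpen_interior l hl
  obtain ⟨S, hS0, hS⟩ := hK.isBounded.subset_closedBall_lt 0 k
  obtain ⟨R, hR0, hR⟩ := hL.isBounded.subset_closedBall_lt 0 l
  have hs : 0 < σ / (2 * S) := by positivity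
  set s := σ / (2 * S) with hs_def
  have ht : 0 < 2 * R / (s * ρ) := by positivity
  set t := 2 * R / (s * ρ) with ht_def
  refine ⟨t / 1, 1, t, one_pos, ht, AffineEquiv.homothetyUnitsMulHom k (Units.mk0 s hs.ne') |>.trans
    (AffineEquiv.constVAdd ℝ Plane (l - k)), l - t • l, ?_, ?_, rfl⟩
  · rw [one_smul]
    rintro _ ⟨y, hy, rfl⟩
    apply interior_subset
    apply hlσ
    have := hS hy
    rw [mem_closedBall_iff_norm] at this
    rw [mem_ball_iff_norm]
    have e : (AffineEquiv.homothetyUnitsMulHom k (Units.mk0 s hs.ne') |>.trans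
      (AffineEquiv.constVAdd ℝ Plane (l - k))) y - l = s • (y - k) := by
      simp [AffineMap.homothety_apply]
    rw [e, norm_smul, Real.norm_of_nonneg hs.le]
    calc s * ‖y - k‖ ≤ s * S := by gcongr
      _ = σ / 2 := by rw [hs_def]; field_simp
      _ < σ := by linarith
  · intro z hz
    have := hR hz
    rw [mem_closedBall_iff_norm] at this
    rw [Set.mem_add]
    refine ⟨z - (l - t • l), ?_, _, rfl, by abel⟩
    refine ⟨l + t⁻¹ • (z - l), ⟨k + (s * t)⁻¹ • (z - l), ?_, ?_⟩, ?_⟩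
    · apply interior_subset
      apply hkρ
      rw [mem_ball_iff_norm, add_sub_cancel_left, norm_smul, Real.norm_of_nonneg (by positivity)]
      calc (s * t)⁻¹ * ‖z - l‖ ≤ (s * t)⁻¹ * R := by gcongr
        _ = ρ / 2 := by rw [ht_def]; field_simp
        _ < ρ := by linarith
    · simp only [AffineEquiv.trans_apply, AffineEquiv.constVAdd_apply,
        AffineEquiv.coe_homothetyUnitsMulHom_apply, AffineMap.homothety_apply, Units.val_mk0,
        vsub_eq_sub, vadd_eq_add, add_sub_cancel_left, smul_smul]
      rw [show s * (s * t)⁻¹ = t⁻¹ by field_simp]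
      abel
    · simp only [smul_add, smul_smul, mul_inv_cancel₀ ht.ne', one_smul]
      abel

/-- The minimum in the definition of the Banach–Mazur distance exists. -/
theorem banachMazurDist_isLeast {K L : Set Plane} (hK : IsCompact K) (hL : IsCompact L)
    (hK' : (interior K).Nonempty) (hL' : (interior L).Nonempty) :
    IsLeast (banachMazurRatios K L) (banachMazurDist K L) := by
  suffices h : ∃ r, IsLeast (banachMazurRatios K L) r by
    obtain ⟨r, hr⟩ := h
    rw [banachMazurDist, hr.csInf_eq]
    exact hr
  obtain ⟨r₀, hr₀⟩ := banachMazurRatios_nonempty hK hL hK' hL'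
  let F : (ℝ × (Plane →L[ℝ] Plane) × Plane × Plane) → Plane → Plane :=
    fun p k => p.1 • (p.2.1 k + p.2.2.1) + p.2.2.2
  let C : Set (ℝ × (Plane →L[ℝ] Plane) × Plane × Plane) :=
    {p | 0 ≤ p.1 ∧ p.1 ≤ r₀ ∧ (∀ k ∈ K, p.2.1 k + p.2.2.1 ∈ L) ∧ ∀ l ∈ L, ∃ k ∈ K, F p k = l}
  -- every ratio up to `r₀` comes from a point of `C`
  have key : ∀ r ∈ banachMazurRatios K L, r ≤ r₀ → ∃ p ∈ C, p.1 = r := by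
    rintro r ⟨a, b, ha, hb, A, x, h1, h2, rfl⟩ hr
    refine ⟨(b / a, a • (A.linear : Plane →ₗ[ℝ] Plane).toContinuousLinearMap, a • A 0, x),
      ⟨by positivity, hr, ?_, ?_⟩, rfl⟩
    · intro k hk
      apply h1
      refine ⟨A k, ⟨k, hk, rfl⟩, ?_⟩
      have := A.map_vadd 0 k
      simp only [vadd_eq_add, add_zero] at this
      simp [this, smul_add]
    · intro l hl
      obtain ⟨y, ⟨_, ⟨k, hk, rfl⟩, rfl⟩, x', rfl, rfl⟩ := Set.mem_add.1 (h2 hl)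
      refine ⟨k, hk, ?_⟩
      have := A.map_vadd 0 k
      simp only [vadd_eq_add, add_zero] at this
      simp [F, this, smul_add, smul_smul, div_mul_cancel₀ b ha.ne']
  have hclosed : IsClosed C := by
    have hF : Continuous fun q : (ℝ × (Plane →L[ℝ] Plane) × Plane × Plane) × K =>
        F q.1 q.2 := by
      simp only [F]
      fun_prop
    have h1 : IsClosed {p : ℝ × (Plane →L[ℝ] Plane) × Plane × Plane |
        ∀ k ∈ K, p.2.1 k + p.2.2.1 ∈ L} := by
      simp only [Set.ofPred_forall]
      refine isClosed_iInter fun k => isClosed_iInter fun _ => hL.isClosed.preimage ?_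
      fun_prop
    have h2 : IsClosed {p : ℝ × (Plane →L[ℝ] Plane) × Plane × Plane |
        ∀ l ∈ L, ∃ k ∈ K, F p k = l} := by
      simp only [Set.ofPred_forall]
      refine isClosed_iInter fun l => isClosed_iInter fun _ => ?_
      have : CompactSpace K := isCompact_iff_compactSpace.1 hK
      have h3 := (isClosedMap_fst_of_compactSpace (X := ℝ × (Plane →L[ℝ] Plane) × Plane × Plane)
        (Y := K)) _ ((isClosed_singleton (x := l)).preimage hF)
      have e : {p | ∃ k ∈ K, F p k = l} = Prod.fst ''
          ((fun q : (ℝ × (Plane →L[ℝ] Plane) × Plane × Plane) × K => F q.1 q.2) ⁻¹' {l}) := by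
        ext p
        constructor
        · rintro ⟨k, hk, hkl⟩
          exact ⟨(p, ⟨k, hk⟩), hkl, rfl⟩
        · rintro ⟨⟨q, k⟩, hkl, rfl⟩
          exact ⟨k, k.2, hkl⟩
      rw [e]
      exact h3
    exact (isClosed_le continuous_const continuous_fst).inter
      ((isClosed_le continuous_fst continuous_const).inter (h1.inter h2))
  obtain ⟨k₀, hk₀⟩ := hK'
  obtain ⟨l₀, hl₀⟩ := hL'
  obtain ⟨ρ, hρ, hkρ⟩ := Metric.isOpen_iff.1 isOpen_interior k₀ hk₀
  obtain ⟨R, hR0, hR⟩ := hL.isBounded.subset_closedBall_lt 0 0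
  have hLR : ∀ l ∈ L, ‖l‖ ≤ R := fun l hl => by simpa using hR hl
  have hr0 : 0 ≤ r₀ := by
    obtain ⟨a, b, ha, hb, -, -, -, -, rfl⟩ := hr₀
    positivity
  have hbdd : Bornology.IsBounded C := by
    have hsub : C ⊆ Metric.closedBall 0 r₀ ×ˢ Metric.closedBall 0 (4 * R / ρ) ×ˢ
        Metric.closedBall 0 (R + 4 * R / ρ * ‖k₀‖) ×ˢ Metric.closedBall 0 (R + r₀ * R) := by
      rintro ⟨r, M, b, x⟩ ⟨h1, h2, h3, h4⟩
      simp only at h1 h2 h3 h4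
      have hM : ‖M‖ ≤ 4 * R / ρ := by
        refine M.opNorm_le_bound (by positivity) fun v => ?_
        rcases eq_or_ne v 0 with rfl | hv
        · simp
        have hv' : 0 < ‖v‖ := norm_pos_iff.2 hv
        have hu : k₀ + (ρ / (2 * ‖v‖)) • v ∈ K := by
          apply interior_subset
          apply hkρ
          rw [mem_ball_iff_norm, add_sub_cancel_left, norm_smul,
            Real.norm_of_nonneg (by positivity)]
          rw [show ρ / (2 * ‖v‖) * ‖v‖ = ρ / 2 by field_simp]
          linarith
        have e1 := hLR _ (h3 _ hu)
        have e2 := hLR _ (h3 _ (interior_subset hk₀))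
        have e3 : ‖(ρ / (2 * ‖v‖)) • M v‖ ≤ R + R := by
          have : (ρ / (2 * ‖v‖)) • M v = (M (k₀ + (ρ / (2 * ‖v‖)) • v) + b) - (M k₀ + b) := by
            rw [map_add, map_smul]; abel
          rw [this]
          exact (norm_sub_le _ _).trans (add_le_add e1 e2)
        rw [norm_smul, Real.norm_of_nonneg (by positivity)] at e3
        calc ‖M v‖ = (2 * ‖v‖ / ρ) * (ρ / (2 * ‖v‖) * ‖M v‖) := by field_simp
          _ ≤ (2 * ‖v‖ / ρ) * (R + R) := by gcongr
          _ = 4 * R / ρ * ‖v‖ := by ring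
      have e2 := hLR _ (h3 _ (interior_subset hk₀))
      refine ⟨by simpa [abs_of_nonneg h1] using h2, by simpa using hM, ?_, ?_⟩
      · have : b = (M k₀ + b) - M k₀ := by abel
        rw [mem_closedBall_zero_iff]
        change ‖b‖ ≤ _
        rw [this]
        refine (norm_sub_le _ _).trans (add_le_add e2 ((M.le_opNorm _).trans ?_))
        gcongr
      · obtain ⟨k, hk, hkl⟩ := h4 l₀ (interior_subset hl₀)
        have : x = l₀ - r • (M k + b) := by rw [← hkl]; simp [F]
        rw [mem_closedBall_zero_iff]
        change ‖x‖ ≤ _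
        rw [this]
        refine (norm_sub_le _ _).trans (add_le_add (hLR _ (interior_subset hl₀)) ?_)
        rw [norm_smul, Real.norm_of_nonneg h1]
        have := hLR _ (h3 k hk)
        gcongr
    refine Bornology.IsBounded.subset ?_ hsub
    exact Metric.isBounded_closedBall.prod (Metric.isBounded_closedBall.prod
      (Metric.isBounded_closedBall.prod Metric.isBounded_closedBall))
  have hcomp : IsCompact C := by
    have : ProperSpace (Plane →L[ℝ] Plane) := FiniteDimensional.proper ℝ _
    exact Metric.isCompact_of_isClosed_isBounded hclosed hbdd
  obtain ⟨p₀, hp₀, -⟩ := key r₀ hr₀ le_rfl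
  obtain ⟨⟨r, M, b, x⟩, hpC, hmin⟩ := hcomp.exists_isMinOn ⟨p₀, hp₀⟩ continuous_fst.continuousOn
  refine ⟨r, ?_, ?_⟩
  · obtain ⟨h1, h2, h3, h4⟩ := hpC
    simp only at h1 h2 h3 h4
    -- `L` has interior points and lies in a translate of the range of `r • M`
    have hsurj : Function.Surjective (r • M) := by
      have hspan : ∀ v : Plane, v ∈ LinearMap.range (r • M : Plane →L[ℝ] Plane).toLinearMap := by
        intro v
        obtain ⟨σ, hσ, hlσ⟩ := Metric.isOpen_iff.1 isOpen_interior l₀ hl₀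
        rcases eq_or_ne v 0 with rfl | hv
        · exact Submodule.zero_mem _
        have hv' : 0 < ‖v‖ := norm_pos_iff.2 hv
        have hu : l₀ + (σ / (2 * ‖v‖)) • v ∈ L := by
          apply interior_subset
          apply hlσ
          rw [mem_ball_iff_norm, add_sub_cancel_left, norm_smul,
            Real.norm_of_nonneg (by positivity)]
          rw [show σ / (2 * ‖v‖) * ‖v‖ = σ / 2 by field_simp]
          linarith
        obtain ⟨k1, -, e1⟩ := h4 _ hu
        obtain ⟨k2, -, e2⟩ := h4 _ (interior_subset hl₀)
        have hne : σ / (2 * ‖v‖) ≠ 0 := by positivity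
        rw [← Submodule.smul_mem_iff _ hne]
        refine ⟨k1 - k2, ?_⟩
        have : (σ / (2 * ‖v‖)) • v = F (r, M, b, x) k1 - F (r, M, b, x) k2 := by
          rw [e1, e2]; abel
        rw [this]
        simp only [F, ContinuousLinearMap.coe_coe, smul_apply, map_sub,
          smul_add]
        abel
      intro v
      exact hspan v
    have hr : r ≠ 0 := by
      rintro rfl
      obtain ⟨v, hv⟩ := exists_ne (0 : Plane)
      obtain ⟨w, hw⟩ := hsurj v
      apply hv
      rw [← hw]
      simp
    have hMs : Function.Surjective (M : Plane →ₗ[ℝ] Plane) := by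
      intro v
      obtain ⟨w, hw⟩ := hsurj v
      exact ⟨r • w, by rw [← hw]; simp⟩
    have hMi : Function.Injective (M : Plane →ₗ[ℝ] Plane) :=
      LinearMap.injective_iff_surjective.2 hMs
    let A : Plane ≃ᵃ[ℝ] Plane :=
      (LinearEquiv.ofBijective (M : Plane →ₗ[ℝ] Plane) ⟨hMi, hMs⟩).toAffineEquiv.trans
        (AffineEquiv.constVAdd ℝ Plane b)
    have hA : ∀ k, A k = M k + b := fun k => add_comm _ _
    refine ⟨1, r, one_pos, lt_of_le_of_ne h1 hr.symm, A, x, ?_, ?_, by simp⟩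
    · rw [one_smul]
      rintro _ ⟨k, hk, rfl⟩
      rw [hA]
      exact h3 k hk
    · intro l hl
      obtain ⟨k, hk, hkl⟩ := h4 l hl
      rw [Set.mem_add]
      refine ⟨r • A k, ⟨A k, ⟨k, hk, rfl⟩, rfl⟩, x, rfl, ?_⟩
      rw [hA, ← hkl]
  · intro r' hr'
    by_contra! hlt
    obtain ⟨p, hp, hpr⟩ := key r' hr' (hlt.le.trans hpC.2.1)
    have := hmin hp
    simp only [Set.mem_ofPred_eq] at this
    rw [hpr] at this
    exact absurd this (not_le.2 hlt)

/-- For a non-degenerate triangle, the norm of `IsUnitRegularNorm` exists and is unique. -/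
theorem existsUnique_isUnitRegularNorm {p : Fin 3 → Plane} (hp : AffineIndependent ℝ p) :
    ∃! N : Plane → ℝ, IsUnitRegularNorm p N := by
  have hli : LinearIndependent ℝ ![p 1 - p 0, p 2 - p 0] := by
    have h := (affineIndependent_iff_linearIndependent_vsub ℝ p 0).1 hp
    have h' := h.comp (![⟨1, by decide⟩, ⟨2, by decide⟩] : Fin 2 → {x : Fin 3 // x ≠ 0})
      (by intro i j; fin_cases i <;> fin_cases j <;> simp)
    have e : ![p 1 - p 0, p 2 - p 0] = (fun i : {x : Fin 3 // x ≠ 0} => (p i -ᵥ p 0 : Plane)) ∘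
        (![⟨1, by decide⟩, ⟨2, by decide⟩] : Fin 2 → {x : Fin 3 // x ≠ 0}) := by
      ext i : 1
      fin_cases i <;> rfl
    rw [e]
    exact h'
  let B : Module.Basis (Fin 2) ℝ Plane := basisOfLinearIndependentOfCardEqFinrank hli (by simp)
  have hB0 : B 0 = p 1 - p 0 := by simp [B]
  have hB1 : B 1 = p 2 - p 0 := by simp [B]
  have hv : ∀ v, v = B.coord 0 v • (p 1 - p 0) + B.coord 1 v • (p 2 - p 0) := by
    intro v
    conv_lhs => rw [← B.sum_repr v]
    rw [Fin.sum_univ_two, hB0, hB1]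
    rfl
  have c00 : B.coord 0 (p 1 - p 0) = 1 := by rw [← hB0]; simp
  have c01 : B.coord 0 (p 2 - p 0) = 0 := by rw [← hB1]; simp
  have c10 : B.coord 1 (p 1 - p 0) = 0 := by rw [← hB0]; simp
  have c11 : B.coord 1 (p 2 - p 0) = 1 := by rw [← hB1]; simp
  let Q : QuadraticForm ℝ Plane := QuadraticMap.linMulLin (B.coord 0) (B.coord 0) +
    QuadraticMap.linMulLin (B.coord 0) (B.coord 1) +
    QuadraticMap.linMulLin (B.coord 1) (B.coord 1)
  have hQ : ∀ v, Q v = B.coord 0 v * B.coord 0 v + B.coord 0 v * B.coord 1 v +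
    B.coord 1 v * B.coord 1 v := fun v => rfl
  have key : ∀ N, IsUnitRegularNorm p N → ∀ v, N v = √(Q v) := by
    rintro N ⟨⟨Q', hQ', hN⟩, hside⟩ v
    have h1 : ∀ i j, i ≠ j → Q' (p i - p j) = 1 := by
      intro i j hij
      have := hside i j hij
      rwa [hN, Real.sqrt_eq_one] at this
    have e1 := h1 1 0 (by decide)
    have e2 := h1 2 0 (by decide)
    have e3 := h1 1 2 (by decide)
    rw [show p 1 - p 2 = (p 1 - p 0) + -(p 2 - p 0) by abel, QuadraticMap.map_add Q',
      QuadraticMap.map_neg, QuadraticMap.polar_neg_right, e1, e2] at e3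
    rw [hN]
    congr 1
    conv_lhs => rw [hv v]
    rw [QuadraticMap.map_add Q', QuadraticMap.map_smul, QuadraticMap.map_smul,
      QuadraticMap.polar_smul_left, QuadraticMap.polar_smul_right, e1, e2, hQ]
    have e4 : QuadraticMap.polar Q' (p 1 - p 0) (p 2 - p 0) = 1 := by linarith
    rw [e4]
    simp only [smul_eq_mul]
    ring
  refine ⟨fun v => √(Q v), ⟨⟨Q, ?_, fun _ => rfl⟩, ?_⟩, fun N hN => funext (key N hN)⟩
  · intro v hv0
    rw [hQ]
    by_contra! hle
    have h0 : B.coord 0 v = 0 := by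
      nlinarith [sq_nonneg (B.coord 0 v + 2 * B.coord 1 v), sq_nonneg (B.coord 0 v)]
    have h1 : B.coord 1 v = 0 := by
      nlinarith [sq_nonneg (B.coord 1 v + 2 * B.coord 0 v), sq_nonneg (B.coord 1 v)]
    apply hv0
    rw [hv v, h0, h1]
    simp
  · have d0 : ∀ i, B.coord 0 (p i - p 0) = ![0, 1, 0] i := by
      intro i; fin_cases i
      · simp
      · exact c00
      · exact c01
    have d1 : ∀ i, B.coord 1 (p i - p 0) = ![0, 0, 1] i := by
      intro i; fin_cases i
      · simp
      · exact c10
      · exact c11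
    intro i j hij
    simp only
    rw [show p i - p j = (p i - p 0) - (p j - p 0) by abel, Real.sqrt_eq_one, hQ,
      map_sub (B.coord 0) (p i - p 0), map_sub (B.coord 1) (p i - p 0), d0, d0, d1, d1]
    fin_cases i <;> fin_cases j <;> simp at hij ⊢

/-! Let abc be a triangle of maximal area in K. The parallels to its sides through the opposite
vertices bound a triangle that contains K, and the barycentric coordinates d₁, d₂, d₃ of o in it
(the `depth`s) are positive with sum 1. The polars of these three parallels are points of K* that
cut K* into three sectors; the centroid g of abc cuts K into three sectors as well.

Over the side ab, let y be a point of K farthest out. Adding y to the triangle and the polar of the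
support line at y to K* gives doubled areas X, Y of corresponding parts with XY = 1/(2d₁) + 1/(2d₂),
whatever K is (`cornerArea_basic`). AM-GM on the mixed products turns this into (ΣX)(ΣY) ≥ 2(1/d₁ +
1/d₂ + 1/d₃) + 9 ≥ 27 (`volumeProduct_core`), which is Mahler's inequality, while the hypothesis
bounds the left side by 27(1 + ε).

Stability: if y lies at height n > 0 beyond ab, support lines parallel to ay and yb improve XY by at
least about n(1 - n) (`exists_cornerArea_refined`, `le_gain`). For small ε this forces n to be O(ε)
or close to 1. The second case is excluded in `IsMaxTriangle.neg_le_bary`: one such side among the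
two considered makes the sectors too unequal for AM-GM, and two of them give a triangle larger than
abc. So K lies between abc and a homothetic copy of ratio 1 + 900ε.

For the centre, compare K with λ₁T + x and K* with the polar of λ₂T + x. This makes the product of
the barycentric coordinates of o in λ₂T + x nearly maximal (`area_le_of_between`), so these
coordinates are within O(√ε) of 1/3 (`variance_le`). The centre of the intermediate triangle is then
expressed through them (`centre_eq`). -/

/-! ### Cross products and areas in angular sectors -/

/-- The cross product (determinant) of two vectors of the plane. -/
def cross (u v : Plane) : ℝ := u 0 * v 1 - u 1 * v 0

/-- The clockwise rotation by a right angle. -/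
def rotCW (v : Plane) : Plane := !₂[v 1, -v 0]

@[simp] theorem rotCW_zero (v : Plane) : rotCW v 0 = v 1 := rfl

@[simp] theorem rotCW_one (v : Plane) : rotCW v 1 = -v 0 := rfl

theorem inner_plane (u v : Plane) : inner ℝ u v = u 0 * v 0 + u 1 * v 1 := by
  simp [PiLp.inner_apply, Fin.sum_univ_two, mul_comm]

theorem plane_ext {u v : Plane} (h0 : u 0 = v 0) (h1 : u 1 = v 1) : u = v := by
  ext i
  fin_cases i
  · exact h0
  · exact h1

theorem inner_rotCW (u v : Plane) : inner ℝ u (rotCW v) = cross u v := by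
  simp [inner_plane, cross]
  ring

/-- The half-open angular sector from `u` counterclockwise to `v`. -/
def sector (u v : Plane) : Set Plane := {x | 0 ≤ cross u x ∧ 0 < cross x v}

/-- `w` is a nonzero point of the closed cone spanned by `u` and `v`. -/
def InCone (u v w : Plane) : Prop := ∃ b c : ℝ, 0 ≤ b ∧ 0 ≤ c ∧ 0 < b + c ∧ w = b • u + c • v

theorem continuous_cross_left (u : Plane) : Continuous fun x : Plane => cross x u := by
  unfold cross
  fun_prop

theorem continuous_cross_right (u : Plane) : Continuous fun x : Plane => cross u x := by
  unfold cross
  fun_prop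

theorem measurableSet_sector (u v : Plane) : MeasurableSet (sector u v) :=
  (measurableSet_le measurable_const (continuous_cross_right u).measurable).inter
    (measurableSet_lt measurable_const (continuous_cross_left v).measurable)

/-- For w = bu + cv, the number c · (x × v) equals x × w + b · (u × x), which is positive. No
orientation of u, v is needed. -/
theorem sector_subset_left {u v w : Plane} (h : InCone u v w) : sector u w ⊆ sector u v := by
  obtain ⟨b, c, hb, hc, -, rfl⟩ := h
  rintro x ⟨h1, h2⟩
  refine ⟨h1, ?_⟩
  have e : cross x (b • u + c • v) = -(b * cross u x) + c * cross x v := by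
    simp [cross]; ring
  rw [e] at h2
  have h3 : 0 < c * cross x v := by nlinarith [mul_nonneg hb h1]
  exact pos_of_mul_pos_right h3 hc

theorem sector_subset_right {u v w : Plane} (h : InCone u v w) : sector w v ⊆ sector u v := by
  obtain ⟨b, c, hb, hc, hbc, rfl⟩ := h
  rintro x ⟨h1, h2⟩
  refine ⟨?_, h2⟩
  have e : cross (b • u + c • v) x = b * cross u x - c * cross x v := by
    simp [cross]; ring
  rw [e] at h1
  have h3 : 0 ≤ c * cross x v := mul_nonneg hc h2.le
  rcases hb.eq_or_lt with rfl | hb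
  · have hc' : 0 < c := by linarith
    nlinarith [mul_pos hc' h2]
  · by_contra! hlt
    nlinarith [mul_pos_of_neg_of_neg (neg_lt_zero.2 hb) hlt]

theorem disjoint_sector (u v w : Plane) : Disjoint (sector u v) (sector v w) := by
  rw [Set.disjoint_left]
  rintro x ⟨-, h1⟩ ⟨h2, -⟩
  have : cross v x = -cross x v := by simp [cross]; ring
  linarith

theorem volume_triangle_prod :
    volume (regionBetween (fun _ : ℝ => 0) (fun x => 1 - x) (Set.Ioc 0 1)) =
      ENNReal.ofReal (1 / 2) := by
  rw [Measure.volume_eq_prod, volume_regionBetween_eq_integral]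
  · congr 1
    rw [← intervalIntegral.integral_of_le zero_le_one]
    simp only [Pi.sub_apply, sub_zero]
    rw [intervalIntegral.integral_sub (by simp) (by simp)]
    norm_num
  · exact integrableOn_const (by simp)
  · exact (Continuous.integrableOn_Icc (by fun_prop)).mono_set Set.Ioc_subset_Icc_self
  · exact measurableSet_Ioc
  · intro x hx
    linarith [hx.2]

/-- A set that, on the sector from `u` to `v`, contains the triangle with vertices `0, u, v`,
has there at least the area of that triangle. -/
theorem ofReal_cross_le_sector {L : Set Plane} (hL : Convex ℝ L) (h0 : (0 : Plane) ∈ L)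
    {u v : Plane} (hu : u ∈ L) (hv : v ∈ L) :
    ENNReal.ofReal (cross u v / 2) ≤ volume.restrict L (sector u v) := by
  rcases le_or_gt (cross u v) 0 with h | h
  · rw [ENNReal.ofReal_of_nonpos (by linarith)]
    exact zero_le
  rw [Measure.restrict_apply (measurableSet_sector u v)]
  -- The linear map with columns u, v carries the standard simplex to the triangle 0uv; its
  -- determinant is `cross u v`.
  let f : Plane →ₗ[ℝ] Plane := Matrix.toEuclideanLin !![u 0, v 0; u 1, v 1]
  let R : Set (ℝ × ℝ) := regionBetween (fun _ : ℝ => 0) (fun x => 1 - x) (Set.Ioc 0 1)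
  let e : Plane → ℝ × ℝ := fun x => (x 0, x 1)
  have he : MeasurePreserving e volume volume :=
    (volume_preserving_finTwoArrow ℝ).comp (PiLp.volume_preserving_ofLp (Fin 2))
  have hR : MeasurableSet R :=
    measurableSet_regionBetween measurable_const (by fun_prop) measurableSet_Ioc
  have hf : ∀ x : Plane, f x = x 0 • u + x 1 • v := by
    intro x
    apply plane_ext <;> simp [f, Matrix.toLpLin_apply, dotProduct] <;> ring
  have hdet : LinearMap.det f = cross u v := by
    simp only [f, Matrix.toEuclideanLin, Matrix.toLpLin_eq_toLin, LinearMap.det_toLin, Matrix.det_fin_two_of, cross]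
    ring
  have hsub : f '' (e ⁻¹' R) ⊆ sector u v ∩ L := by
    rintro _ ⟨x, ⟨⟨hx1, hx2⟩, hx3, hx4⟩, rfl⟩
    simp only [e] at hx1 hx2 hx3 hx4
    rw [hf]
    refine ⟨⟨?_, ?_⟩, ?_⟩
    · have : cross u (x 0 • u + x 1 • v) = x 1 * cross u v := by simp [cross]; ring
      rw [this]; positivity
    · have : cross (x 0 • u + x 1 • v) v = x 0 * cross u v := by simp [cross]; ring
      rw [this]; positivity
    · have := hL.sum_mem (t := Finset.univ) (w := ![1 - x 0 - x 1, x 0, x 1])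
        (z := ![0, u, v]) (by
          intro i _
          fin_cases i
          · simp; linarith
          · exact hx1.le
          · exact hx3.le) (by simp [Fin.sum_univ_three]; ring) (by
          intro i _
          fin_cases i
          · exact h0
          · exact hu
          · exact hv)
      simpa [Fin.sum_univ_three] using this
  refine le_trans (le_of_eq ?_) (measure_mono hsub)
  rw [Measure.addHaar_image_linearMap, hdet, he.measure_preimage hR.nullMeasurableSet]
  rw [volume_triangle_prod, ← ENNReal.ofReal_mul (abs_nonneg _), abs_of_pos h]
  congr 1
  ring

theorem sector_split {L : Set Plane} {u v w : Plane} (h : InCone u v w) {a b : ℝ}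
    (ha : ENNReal.ofReal (a / 2) ≤ volume.restrict L (sector u w))
    (hb : ENNReal.ofReal (b / 2) ≤ volume.restrict L (sector w v)) :
    ENNReal.ofReal ((a + b) / 2) ≤ volume.restrict L (sector u v) := by
  calc ENNReal.ofReal ((a + b) / 2) = ENNReal.ofReal (a / 2 + b / 2) := by rw [add_div]
    _ ≤ ENNReal.ofReal (a / 2) + ENNReal.ofReal (b / 2) := ENNReal.ofReal_add_le
    _ ≤ volume.restrict L (sector u w) + volume.restrict L (sector w v) := add_le_add ha hb
    _ = volume.restrict L (sector u w ∪ sector w v) :=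
      (measure_union (disjoint_sector u w v) (measurableSet_sector w v)).symm
    _ ≤ _ := measure_mono (Set.union_subset (sector_subset_left h) (sector_subset_right h))

/-- Cyclically consecutive half-open sectors are pairwise disjoint for any u, v, w, so neither
orientation nor covering matters. -/
theorem ofReal_add_le_volume {L : Set Plane} {u v w : Plane} {a b c : ℝ}
    (ha : ENNReal.ofReal (a / 2) ≤ volume.restrict L (sector u v))
    (hb : ENNReal.ofReal (b / 2) ≤ volume.restrict L (sector v w))
    (hc : ENNReal.ofReal (c / 2) ≤ volume.restrict L (sector w u)) :
    ENNReal.ofReal ((a + b + c) / 2) ≤ volume L := by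
  calc ENNReal.ofReal ((a + b + c) / 2) = ENNReal.ofReal (a / 2 + b / 2 + c / 2) := by
        congr 1; ring
    _ ≤ ENNReal.ofReal (a / 2) + ENNReal.ofReal (b / 2) + ENNReal.ofReal (c / 2) :=
      ENNReal.ofReal_add_le.trans (add_le_add_left ENNReal.ofReal_add_le _)
    _ ≤ volume.restrict L (sector u v) + volume.restrict L (sector v w) +
        volume.restrict L (sector w u) := add_le_add (add_le_add ha hb) hc
    _ = volume.restrict L (sector u v ∪ sector v w ∪ sector w u) := by
      rw [measure_union _ (measurableSet_sector w u),
        measure_union (disjoint_sector u v w) (measurableSet_sector v w)]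
      exact Set.disjoint_union_left.2 ⟨(disjoint_sector w u v).symm, disjoint_sector v w u⟩
    _ ≤ volume.restrict L Set.univ := measure_mono (Set.subset_univ _)
    _ = volume L := by simp

theorem ofReal_two_cross_le_sector {L : Set Plane} (hL : Convex ℝ L) (h0 : (0 : Plane) ∈ L)
    {u v w : Plane} (hu : u ∈ L) (hv : v ∈ L) (hw : w ∈ L) (h : InCone u v w) :
    ENNReal.ofReal ((cross u w + cross w v) / 2) ≤ volume.restrict L (sector u v) :=
  sector_split h (ofReal_cross_le_sector hL h0 hu hw) (ofReal_cross_le_sector hL h0 hw hv)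

theorem ofReal_four_cross_le_sector {L : Set Plane} (hL : Convex ℝ L) (h0 : (0 : Plane) ∈ L)
    {u v w x y : Plane} (hu : u ∈ L) (hv : v ∈ L) (hw : w ∈ L) (hx : x ∈ L) (hy : y ∈ L)
    (h : InCone u v w) (hx' : InCone u w x) (hy' : InCone w v y) :
    ENNReal.ofReal (((cross u x + cross x w) + (cross w y + cross y v)) / 2) ≤
      volume.restrict L (sector u v) :=
  sector_split h (ofReal_two_cross_le_sector hL h0 hu hw hx hx')
    (ofReal_two_cross_le_sector hL h0 hw hv hy hy')

/-! ### Polar body and support lines -/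

theorem convex_polarBody (K : Set Plane) : Convex ℝ (polarBody K) := by
  intro x hx y hy a b ha hb hab z hz
  rw [inner_add_left, inner_smul_left, inner_smul_left]
  simp only [conj_trivial]
  nlinarith [mul_le_mul_of_nonneg_left (hx z hz) ha, mul_le_mul_of_nonneg_left (hy z hz) hb]

theorem zero_mem_polarBody (K : Set Plane) : (0 : Plane) ∈ polarBody K := by
  intro y _
  simp

theorem rotCW_mem_polarBody {K : Set Plane} {v : Plane} {h : ℝ} (hh : 0 < h)
    (hv : ∀ x ∈ K, cross x v ≤ h) : h⁻¹ • rotCW v ∈ polarBody K := by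
  intro x hx
  rw [real_inner_comm, inner_smul_right, inner_rotCW, inv_mul_le_one₀ hh]
  exact hv x hx

theorem cross_pos_of_interior {K : Set Plane} (h0 : (0 : Plane) ∈ interior K) {v : Plane}
    (hv : v ≠ 0) : ∃ x ∈ K, 0 < cross x v := by
  have hc : Filter.Tendsto (fun t : ℝ => t • rotCW v) (nhdsWithin 0 (Set.Ioi 0)) (nhds 0) := by
    have : Continuous fun t : ℝ => t • rotCW v := by fun_prop
    simpa using (this.tendsto 0).mono_left nhdsWithin_le_nhds
  have h1 := hc.eventually (mem_interior_iff_mem_nhds.1 h0)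
  obtain ⟨t, ht, ht0⟩ := (h1.and self_mem_nhdsWithin).exists
  refine ⟨_, ht, ?_⟩
  have e : cross (t • rotCW v) v = t * (v 0 ^ 2 + v 1 ^ 2) := by simp [cross]; ring
  rw [e]
  refine mul_pos ht0 ?_
  by_contra! hle
  apply hv
  apply plane_ext
  · simp; nlinarith [sq_nonneg (v 0), sq_nonneg (v 1)]
  · simp; nlinarith [sq_nonneg (v 0), sq_nonneg (v 1)]

theorem exists_support {K : Set Plane} (hK : IsCompact K) (h0 : (0 : Plane) ∈ interior K)
    {v : Plane} (hv : v ≠ 0) :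
    ∃ w ∈ K, 0 < cross w v ∧ ∀ x ∈ K, cross x v ≤ cross w v := by
  obtain ⟨w, hw, hmax⟩ := hK.exists_isMaxOn ⟨0, interior_subset h0⟩
    (continuous_cross_left v).continuousOn
  obtain ⟨x, hx, hpos⟩ := cross_pos_of_interior h0 hv
  exact ⟨w, hw, hpos.trans_le (hmax hx), fun x hx => hmax hx⟩

theorem cross_smul_rotCW (q r v : Plane) :
    cross q r • rotCW v = inner ℝ v r • q - inner ℝ v q • r := by
  apply plane_ext <;> simp [cross, inner_plane] <;> ring

/-- The Binet–Cauchy identity; it relates areas in K and in K* through pairings, which are at most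
1. -/
theorem cross_mul_cross (a b q r : Plane) :
    cross a b * cross q r = inner ℝ a q * inner ℝ b r - inner ℝ a r * inner ℝ b q := by
  simp only [cross, inner_plane]
  ring

/-- The doubled area of the quadrilateral `0, q, z, r`, where `z` is a multiple of the normal
of `v`. -/
theorem cross_add_cross_polar (v q r : Plane) (h : ℝ) :
    cross q (h⁻¹ • rotCW v) + cross (h⁻¹ • rotCW v) r =
      (inner ℝ v r - inner ℝ v q) / h := by
  simp only [cross, inner_plane, PiLp.smul_apply, rotCW_zero, rotCW_one, smul_eq_mul]
  field_simp
  ring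

/-- By Cramer's rule, the coefficients of the normal of ab in the basis q, r are the changes of the
functionals r and q along ab, up to sign and a positive factor. -/
theorem inCone_polar {a b q r : Plane} {h : ℝ} (hh : 0 < h) (hqr : 0 < cross q r)
    (hr : inner ℝ a r ≤ inner ℝ b r) (hq : inner ℝ b q ≤ inner ℝ a q)
    (hpos : 0 < inner ℝ b r - inner ℝ a r + (inner ℝ a q - inner ℝ b q)) :
    InCone q r (h⁻¹ • rotCW (b - a)) := by
  refine ⟨(inner ℝ b r - inner ℝ a r) / (h * cross q r),
    (inner ℝ a q - inner ℝ b q) / (h * cross q r), ?_, ?_, ?_, ?_⟩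
  · exact div_nonneg (by linarith) (by positivity)
  · exact div_nonneg (by linarith) (by positivity)
  · rw [← add_div]
    positivity
  · have := cross_smul_rotCW q r (b - a)
    rw [inner_sub_left, inner_sub_left] at this
    have e : rotCW (b - a) = (cross q r)⁻¹ • ((inner ℝ b r - inner ℝ a r) • q -
        (inner ℝ b q - inner ℝ a q) • r) := by
      rw [← this, smul_smul, inv_mul_cancel₀ hqr.ne', one_smul]
    rw [e]
    apply plane_ext <;> simp <;> field_simp <;> ring

/-! ### Barycentric coordinates and inscribed triangles of maximal area -/

/-- The doubled signed area of the triangle with vertices `x, y, z`. -/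
def area (x y z : Plane) : ℝ := cross (y - x) (z - x)

theorem area_rotate (x y z : Plane) : area y z x = area x y z := by
  simp only [area, cross, PiLp.sub_apply]
  ring

/-- The coordinate of `x` that belongs to `a`, in barycentric coordinates with respect to the
triangle with vertices `a, b, c`. -/
noncomputable def bary (a b c x : Plane) : ℝ := area x b c / area a b c

theorem bary_combination {a b c : Plane} (h : area a b c ≠ 0) (x : Plane) :
    x = bary a b c x • a + bary b c a x • b + bary c a b x • c := by
  have hb := area_rotate a b c
  have hc := area_rotate b c a
  rw [hb] at hc
  simp only [bary, hb, hc]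
  apply plane_ext <;> simp <;> field_simp <;> simp [area, cross] <;> ring

theorem bary_sum {a b c : Plane} (h : area a b c ≠ 0) (x : Plane) :
    bary a b c x + bary b c a x + bary c a b x = 1 := by
  have hb := area_rotate a b c
  have hc := area_rotate b c a
  rw [hb] at hc
  simp only [bary, hb, hc]
  field_simp
  simp [area, cross]
  ring

/-- `a, b, c` are the vertices, in counterclockwise order, of a triangle of maximal area among
those contained in `K`. -/
structure IsMaxTriangle (K : Set Plane) (a b c : Plane) : Prop where
  mem₁ : a ∈ K
  mem₂ : b ∈ K
  mem₃ : c ∈ K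
  pos : 0 < area a b c
  max : ∀ x ∈ K, ∀ y ∈ K, ∀ z ∈ K, area x y z ≤ area a b c

theorem IsMaxTriangle.rotate {K : Set Plane} {a b c : Plane} (h : IsMaxTriangle K a b c) :
    IsMaxTriangle K b c a :=
  ⟨h.mem₂, h.mem₃, h.mem₁, by rw [area_rotate]; exact h.pos, by rw [area_rotate]; exact h.max⟩

theorem exists_isMaxTriangle {K : Set Plane} (hK : IsCompact K) (h0 : (0 : Plane) ∈ interior K) :
    ∃ a b c, IsMaxTriangle K a b c := by
  have hcont : Continuous fun p : Plane × Plane × Plane => area p.1 p.2.1 p.2.2 := by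
    unfold area cross
    fun_prop
  have h0K := interior_subset h0
  obtain ⟨⟨a, b, c⟩, ⟨ha, hb, hc⟩, hmax⟩ := (hK.prod (hK.prod hK)).exists_isMaxOn
    ⟨(0, 0, 0), h0K, h0K, h0K⟩ hcont.continuousOn
  have hmax' : ∀ x ∈ K, ∀ y ∈ K, ∀ z ∈ K, area x y z ≤ area a b c :=
    fun x hx y hy z hz => hmax (show (x, y, z) ∈ _ from ⟨hx, hy, hz⟩)
  refine ⟨a, b, c, ha, hb, hc, ?_, hmax'⟩
  obtain ⟨x, hx, hx'⟩ := cross_pos_of_interior h0 (v := !₂[0, 1]) (by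
    intro h
    simpa using congrArg (fun v : Plane => v 1) h)
  have hx0 : x ≠ 0 := by
    rintro rfl
    simp [cross] at hx'
  obtain ⟨y, hy, hy'⟩ := cross_pos_of_interior h0 hx0
  refine lt_of_lt_of_le ?_ (hmax' 0 h0K y hy x hx)
  simpa [area] using hy'

section MaxTriangle

variable {K : Set Plane} {a b c : Plane}

/-- Replacing the vertex a by x cannot increase the area, so K does not cross the parallel to bc
through a. -/
theorem IsMaxTriangle.bary_le_one (h : IsMaxTriangle K a b c) {x : Plane} (hx : x ∈ K) :
    bary a b c x ≤ 1 := by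
  rw [bary, div_le_one h.pos]
  exact h.max x hx b h.mem₂ c h.mem₃

theorem IsMaxTriangle.neg_one_le_bary (h : IsMaxTriangle K a b c) {x : Plane} (hx : x ∈ K) :
    -1 ≤ bary a b c x := by
  rw [bary, le_div_iff₀ h.pos]
  have := h.max x hx c h.mem₃ b h.mem₂
  have e : area x c b = -area x b c := by simp only [area, cross]; ring
  linarith

/-- Half of the distance of the origin from the line through `a` parallel to `bc`, in the units
in which the corresponding altitude of `abc` has length one. -/
noncomputable def depth (a b c : Plane) : ℝ := (1 - bary a b c 0) / 2

theorem cross_eq_depth (h : area a b c ≠ 0) : cross b c = area a b c * (1 - 2 * depth a b c) := by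
  simp only [depth, bary]
  field_simp
  simp [area]

theorem depth_sum (h : area a b c ≠ 0) : depth a b c + depth b c a + depth c a b = 1 := by
  have := bary_sum h 0
  simp only [depth]
  linarith

theorem area_eq_cross_sub (x b c : Plane) : area x b c = cross b c - cross x (c - b) := by
  simp only [area, cross, PiLp.sub_apply]
  ring

theorem IsMaxTriangle.ne (h : IsMaxTriangle K a b c) : c - b ≠ 0 := by
  intro hcb
  have := h.pos
  rw [sub_eq_zero.1 hcb] at this
  simp only [area, cross, PiLp.sub_apply] at this
  linarith

/-- The coordinate of a is at most 1 on K, and at the interior point o it is exceeded somewhere on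
K, so it is below 1 there. -/
theorem IsMaxTriangle.depth_pos (h : IsMaxTriangle K a b c) (h0 : (0 : Plane) ∈ interior K) :
    0 < depth a b c := by
  have hv : -(c - b) ≠ 0 := neg_ne_zero.2 h.ne
  obtain ⟨x, hx, hpos⟩ := cross_pos_of_interior h0 hv
  have h1 := h.max x hx b h.mem₂ c h.mem₃
  rw [area_eq_cross_sub] at h1
  have e : cross x (-(c - b)) = - cross x (c - b) := by simp [cross]; ring
  have h2 := cross_eq_depth h.pos.ne'
  have h3 : 0 < area a b c * (2 * depth a b c) := by linarith
  have := pos_of_mul_pos_right h3 h.pos.le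
  linarith

/-- The vertex of the polar of the triangle circumscribed about `abc`, that is, the functional
equal to `1` on the line through `a` parallel to `bc`. -/
noncomputable def polarVertex (a b c : Plane) : Plane :=
  (2 * (area a b c * depth a b c))⁻¹ • rotCW (-(c - b))

theorem inner_polarVertex (h : 0 < area a b c) (hd : 0 < depth a b c) (x : Plane) :
    inner ℝ x (polarVertex a b c) = 1 - (1 - bary a b c x) / (2 * depth a b c) := by
  rw [polarVertex, inner_smul_right, inner_rotCW]
  have h1 := cross_eq_depth h.ne'
  have e : cross x (-(c - b)) = - cross x (c - b) := by simp [cross]; ring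
  rw [e, bary, area_eq_cross_sub x, h1]
  field_simp
  ring

theorem IsMaxTriangle.polarVertex_mem (h : IsMaxTriangle K a b c) (hd : 0 < depth a b c) :
    polarVertex a b c ∈ polarBody K := by
  intro x hx
  rw [real_inner_comm, inner_polarVertex h.pos hd]
  have := h.bary_le_one hx
  have : 0 ≤ (1 - bary a b c x) / (2 * depth a b c) := div_nonneg (by linarith) (by linarith)
  linarith

theorem bary_self (h : area a b c ≠ 0) : bary a b c a = 1 := div_self h

theorem bary_second : bary a b c b = 0 := by
  simp only [bary, area, cross, PiLp.sub_apply]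
  ring_nf

theorem bary_third : bary a b c c = 0 := by
  simp only [bary, area, cross, PiLp.sub_apply]
  ring_nf

theorem cross_polarVertex (h : 0 < area a b c) (h1 : 0 < depth a b c) (h2 : 0 < depth b c a) :
    0 < cross (polarVertex a b c) (polarVertex b c a) := by
  have e : cross (polarVertex a b c) (polarVertex b c a) =
      (2 * (area a b c * depth a b c))⁻¹ * (2 * (area b c a * depth b c a))⁻¹ * area a b c := by
    simp only [polarVertex, cross, area, PiLp.smul_apply, rotCW_zero, rotCW_one, PiLp.sub_apply,
      PiLp.neg_apply, smul_eq_mul]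
    ring
  rw [e, area_rotate a b c]
  positivity

end MaxTriangle

theorem cross_sub_sub_bary {a b c : Plane} (h : area a b c ≠ 0) (w y : Plane) :
    cross (w - a) (y - a) =
      area a b c * (bary b c a w * bary c a b y - bary c a b w * bary b c a y) := by
  have hw := bary_combination h w
  have hy := bary_combination h y
  have sw := bary_sum h w
  have sy := bary_sum h y
  set w1 := bary a b c w
  set w2 := bary b c a w
  set w3 := bary c a b w
  set y1 := bary a b c y
  set y2 := bary b c a y
  set y3 := bary c a b y
  clear_value y1 y2 y3 w1 w2 w3
  obtain rfl : w1 = 1 - w2 - w3 := by linarith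
  obtain rfl : y1 = 1 - y2 - y3 := by linarith
  rw [hw, hy]
  simp [cross, area]
  ring

/-! ### Angular position seen from the centroid -/

section Cones

variable {a b c g : Plane}

theorem inCone_corner (h : area a b c ≠ 0) (hg : (3 : ℝ) • g = a + b + c) {y : Plane}
    (h1 : bary c a b y ≤ bary a b c y) (h2 : bary c a b y ≤ bary b c a y)
    (h3 : bary c a b y < 1 / 3) : InCone (a - g) (b - g) (y - g) := by
  have hs := bary_sum h y
  refine ⟨bary a b c y - bary c a b y, bary b c a y - bary c a b y, by linarith, by linarith,
    by linarith, ?_⟩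
  have hy := bary_combination h y
  have hg' : g = (1 / 3 : ℝ) • (a + b + c) := by rw [← hg, smul_smul]; norm_num
  set y1 := bary a b c y
  set y2 := bary b c a y
  set y3 := bary c a b y
  clear_value y1 y2 y3
  obtain rfl : y1 = 1 - y2 - y3 := by linarith
  rw [hy, hg']
  apply plane_ext <;> simp <;> ring

/-- A point w strictly beyond the line ay (`hP`), no farther beyond ab than y, is seen from g
between a and y. This lets the sector of K be cut at w. -/
theorem inCone_left (h : area a b c ≠ 0) (hg : (3 : ℝ) • g = a + b + c) {y w : Plane}
    (hy3 : bary c a b y < 0) (hy1 : bary a b c y ≤ 1)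
    (hw1 : bary a b c w ≤ 1) (hw3 : bary c a b y ≤ bary c a b w)
    (hP : 0 < bary b c a w * bary c a b y - bary c a b w * bary b c a y) :
    InCone (a - g) (y - g) (w - g) := by
  have sy := bary_sum h y
  have sw := bary_sum h w
  have hy := bary_combination h y
  have hw := bary_combination h w
  have hg' : g = (1 / 3 : ℝ) • (a + b + c) := by rw [← hg, smul_smul]; norm_num
  set y1 := bary a b c y
  set y2 := bary b c a y
  set y3 := bary c a b y
  set w1 := bary a b c w
  set w2 := bary b c a w
  set w3 := bary c a b w
  clear_value y1 y2 y3 w1 w2 w3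
  have hd : 0 < y2 - y3 := by linarith
  -- Divided by 3, this determinant is the ratio of the signed areas of gwy and abc.
  have hD : 0 < (w2 * y3 - w3 * y2) - (w1 * y3 - w3 * y1) + (w1 * y2 - w2 * y1) := by
    have e : -y3 * ((w2 * y3 - w3 * y2) - (w1 * y3 - w3 * y1) + (w1 * y2 - w2 * y1)) =
        (1 - 3 * y3) * (w2 * y3 - w3 * y2) + (1 - y1 - 2 * y3) * (w3 - y3) := by
      obtain rfl : y2 = 1 - y1 - y3 := by linarith
      obtain rfl : w2 = 1 - w1 - w3 := by linarith
      ring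
    refine pos_of_mul_pos_right (a := -y3) ?_ (by linarith)
    rw [e]
    have h1 : 0 < (1 - 3 * y3) * (w2 * y3 - w3 * y2) := mul_pos (by linarith) hP
    have h2 : 0 ≤ (1 - y1 - 2 * y3) * (w3 - y3) := mul_nonneg (by linarith) (by linarith)
    linarith
  have hw23 : w3 ≤ w2 := by
    by_contra! hlt
    nlinarith
  refine ⟨((w2 * y3 - w3 * y2) - (w1 * y3 - w3 * y1) + (w1 * y2 - w2 * y1)) / (y2 - y3),
    (w2 - w3) / (y2 - y3), by positivity, div_nonneg (by linarith) hd.le, ?_, ?_⟩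
  · have := div_pos hD hd
    have : 0 ≤ (w2 - w3) / (y2 - y3) := div_nonneg (by linarith) hd.le
    linarith
  · obtain rfl : y1 = 1 - y2 - y3 := by linarith
    obtain rfl : w1 = 1 - w2 - w3 := by linarith
    rw [hy, hw, hg']
    apply plane_ext <;> simp <;> field_simp <;> ring

theorem inCone_right (h : area a b c ≠ 0) (hg : (3 : ℝ) • g = a + b + c) {y w : Plane}
    (hy3 : bary c a b y < 0) (hy2 : bary b c a y ≤ 1)
    (hw2 : bary b c a w ≤ 1) (hw3 : bary c a b y ≤ bary c a b w)
    (hP : 0 < bary a b c w * bary c a b y - bary c a b w * bary a b c y) :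
    InCone (y - g) (b - g) (w - g) := by
  have sy := bary_sum h y
  have sw := bary_sum h w
  have hy := bary_combination h y
  have hw := bary_combination h w
  have hg' : g = (1 / 3 : ℝ) • (a + b + c) := by rw [← hg, smul_smul]; norm_num
  set y1 := bary a b c y
  set y2 := bary b c a y
  set y3 := bary c a b y
  set w1 := bary a b c w
  set w2 := bary b c a w
  set w3 := bary c a b w
  clear_value y1 y2 y3 w1 w2 w3
  have hd : 0 < y1 - y3 := by linarith
  have hD : 0 < (w1 * y3 - w3 * y1) - (w2 * y3 - w3 * y2) + (w2 * y1 - w1 * y2) := by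
    have e : -y3 * ((w1 * y3 - w3 * y1) - (w2 * y3 - w3 * y2) + (w2 * y1 - w1 * y2)) =
        (1 - 3 * y3) * (w1 * y3 - w3 * y1) + (1 - y2 - 2 * y3) * (w3 - y3) := by
      obtain rfl : y1 = 1 - y2 - y3 := by linarith
      obtain rfl : w1 = 1 - w2 - w3 := by linarith
      ring
    refine pos_of_mul_pos_right (a := -y3) ?_ (by linarith)
    rw [e]
    have h1 : 0 < (1 - 3 * y3) * (w1 * y3 - w3 * y1) := mul_pos (by linarith) hP
    have h2 : 0 ≤ (1 - y2 - 2 * y3) * (w3 - y3) := mul_nonneg (by linarith) (by linarith)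
    linarith
  have hw13 : w3 ≤ w1 := by
    by_contra! hlt
    nlinarith
  refine ⟨(w1 - w3) / (y1 - y3),
    ((w1 * y3 - w3 * y1) - (w2 * y3 - w3 * y2) + (w2 * y1 - w1 * y2)) / (y1 - y3),
    div_nonneg (by linarith) hd.le, by positivity, ?_, ?_⟩
  · have := div_pos hD hd
    have : 0 ≤ (w1 - w3) / (y1 - y3) := div_nonneg (by linarith) hd.le
    linarith
  · obtain rfl : y1 = 1 - y2 - y3 := by linarith
    obtain rfl : w1 = 1 - w2 - w3 := by linarith
    rw [hy, hw, hg']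
    apply plane_ext <;> simp <;> field_simp <;> ring

end Cones

/-! ### Area of K and of its polar over one side -/

/-- Lower bounds for the doubled areas of the parts of `K` and of its polar that belong to the
side `ab` of the triangle `abc`. The part of `K` is a sector with apex `g`; the term with `g`
cancels in the sum over the three sides. -/
structure CornerArea (K : Set Plane) (a b c g : Plane) (X Y : ℝ) : Prop where
  body : ENNReal.ofReal ((X + cross (b - a) g) / 2) ≤
    volume.restrict {x | x + g ∈ K} (sector (a - g) (b - g))
  polar : ENNReal.ofReal (Y / 2) ≤
    volume.restrict (polarBody K) (sector (polarVertex a b c) (polarVertex b c a))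

theorem mul_le_of_cornerArea {K : Set Plane} {a b c g : Plane} {X₁ Y₁ X₂ Y₂ X₃ Y₃ V : ℝ}
    (h₁ : CornerArea K a b c g X₁ Y₁) (h₂ : CornerArea K b c a g X₂ Y₂)
    (h₃ : CornerArea K c a b g X₃ Y₃) (hX : 0 ≤ X₁ + X₂ + X₃) (hV : 0 ≤ V)
    (hvol : volume K * volume (polarBody K) ≤ ENNReal.ofReal V) :
    (X₁ + X₂ + X₃) * (Y₁ + Y₂ + Y₃) ≤ 4 * V := by
  have hb := ofReal_add_le_volume h₁.body h₂.body h₃.body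
  have hp := ofReal_add_le_volume h₁.polar h₂.polar h₃.polar
  have e : X₁ + cross (b - a) g + (X₂ + cross (c - b) g) + (X₃ + cross (a - c) g) =
      X₁ + X₂ + X₃ := by
    simp only [cross, PiLp.sub_apply]; ring
  have eK : volume {x | x + g ∈ K} = volume K := measure_preimage_add_right volume g K
  rw [e, eK] at hb
  have := (mul_le_mul' hb hp).trans hvol
  rw [← ENNReal.ofReal_mul (by linarith), ENNReal.ofReal_le_ofReal_iff hV] at this
  linarith

theorem cross_sub_eq {a b c : Plane} (h : area a b c ≠ 0) (x : Plane) :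
    cross x (b - a) = area a b c * (1 - 2 * depth c a b - bary c a b x) := by
  have e := area_rotate c a b
  rw [depth, bary, bary, ← e, area_eq_cross_sub x, area_eq_cross_sub 0]
  field_simp
  simp [cross]

theorem inner_inv_smul_rotCW (x v : Plane) (h : ℝ) :
    inner ℝ x (h⁻¹ • rotCW v) = cross x v / h := by
  rw [inner_smul_right, inner_rotCW, inv_mul_eq_div]

/-- The diagonal terms of the right side are exactly c₁ and c₂, and the mixed terms dominate a₁b₂
and a₂b₁. Hence the gains cᵢ - aᵢbᵢ of the two halves simply add. -/
theorem mul_add_le_of_sectors {A₁ A₂ a₁ a₂ b₁ b₂ c₁ c₂ : ℝ} (hA₁ : 0 < A₁) (hA₂ : 0 < A₂)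
    (hb₁ : 0 ≤ b₁) (hb₂ : 0 ≤ b₂) (h₁ : a₁ ≤ A₁) (h₂ : a₂ ≤ A₂) (hc₁ : A₁ * b₁ ≤ c₁)
    (hc₂ : A₂ * b₂ ≤ c₂) :
    (a₁ + a₂) * (b₁ + b₂) + (c₁ - a₁ * b₁) + (c₂ - a₂ * b₂) ≤
      (A₁ + A₂) * (c₁ / A₁ + c₂ / A₂) := by
  have e : (A₁ + A₂) * (c₁ / A₁ + c₂ / A₂) = c₁ + c₂ + A₁ * (c₂ / A₂) + A₂ * (c₁ / A₁) := by
    field_simp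
    ring
  have h3 : b₁ ≤ c₁ / A₁ := by rwa [le_div_iff₀ hA₁, mul_comm]
  have h4 : b₂ ≤ c₂ / A₂ := by rwa [le_div_iff₀ hA₂, mul_comm]
  have h5 := mul_le_mul_of_nonneg_left h4 hA₁.le
  have h6 := mul_le_mul_of_nonneg_left h3 hA₂.le
  have h7 := mul_le_mul_of_nonneg_right h₁ hb₂
  have h8 := mul_le_mul_of_nonneg_right h₂ hb₁
  rw [e]
  nlinarith

section Corner

variable {K : Set Plane} {a b c g : Plane}

theorem convex_translate (hK : Convex ℝ K) (g : Plane) : Convex ℝ {x | x + g ∈ K} := by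
  intro x hx y hy s t hs ht hst
  have := hK hx hy hs ht hst
  have e : s • (x + g) + t • (y + g) = s • x + t • y + g := by
    rw [smul_add, smul_add, add_add_add_comm, ← add_smul, hst, one_smul]
  rwa [e] at this

theorem centroid_mem (hK : Convex ℝ K) (h : IsMaxTriangle K a b c)
    (hg : (3 : ℝ) • g = a + b + c) : g ∈ K := by
  have := hK.sum_mem (t := Finset.univ) (w := ![(1 / 3 : ℝ), 1 / 3, 1 / 3]) (z := ![a, b, c])
    (by intro i _; fin_cases i <;> norm_num) (by simp [Fin.sum_univ_three]; norm_num)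
    (by
      intro i _
      fin_cases i
      · exact h.mem₁
      · exact h.mem₂
      · exact h.mem₃)
  have e : g = (1 / 3 : ℝ) • (a + b + c) := by rw [← hg, smul_smul]; norm_num
  rw [e]
  simpa [Fin.sum_univ_three] using this

theorem IsMaxTriangle.inCone (h : IsMaxTriangle K a b c) (hg : (3 : ℝ) • g = a + b + c)
    {y : Plane} (hy : y ∈ K) (hy3 : bary c a b y ≤ 0) : InCone (a - g) (b - g) (y - g) := by
  have hs := bary_sum h.pos.ne' y
  have h1 := h.bary_le_one hy
  have h2 := h.rotate.bary_le_one hy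
  exact inCone_corner h.pos.ne' hg (by linarith) (by linarith) (by linarith)

theorem cross_sub_add_cross_sub (a b g w : Plane) :
    cross (a - g) (w - g) + cross (w - g) (b - g) = cross w (b - a) + cross (b - a) g := by
  simp only [cross, PiLp.sub_apply]
  ring

theorem IsMaxTriangle.inner_first (h : IsMaxTriangle K a b c) (hd : 0 < depth a b c) :
    inner ℝ a (polarVertex a b c) = 1 := by
  rw [inner_polarVertex h.pos hd, bary_self h.pos.ne']; simp

theorem IsMaxTriangle.inner_second (h : IsMaxTriangle K a b c) (hd : 0 < depth a b c) :
    inner ℝ b (polarVertex a b c) = 1 - 1 / (2 * depth a b c) := by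
  rw [inner_polarVertex h.pos hd, bary_second]; simp

theorem IsMaxTriangle.inner_third (h : IsMaxTriangle K a b c) (hd : 0 < depth a b c) :
    inner ℝ c (polarVertex a b c) = 1 - 1 / (2 * depth a b c) := by
  rw [inner_polarVertex h.pos hd, bary_third]; simp

theorem IsMaxTriangle.cross_polar (h : IsMaxTriangle K a b c) (hd₁ : 0 < depth a b c)
    (hd₂ : 0 < depth b c a) (t : ℝ) :
    cross (polarVertex a b c) (t⁻¹ • rotCW (b - a)) = 1 / (2 * depth a b c) / t ∧
    cross (t⁻¹ • rotCW (b - a)) (polarVertex b c a) = 1 / (2 * depth b c a) / t := by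
  have h1 := h.inner_first hd₁
  have h2 := h.inner_second hd₁
  have h3 := h.rotate.inner_first hd₂
  have h4 := h.rotate.inner_third hd₂
  constructor
  · have e : cross (polarVertex a b c) (t⁻¹ • rotCW (b - a)) =
        (inner ℝ a (polarVertex a b c) - inner ℝ b (polarVertex a b c)) / t := by
      simp only [cross, inner_plane, PiLp.smul_apply, rotCW_zero, rotCW_one, smul_eq_mul,
        PiLp.sub_apply]
      ring
    rw [e, h1, h2]
    ring
  · have e : cross (t⁻¹ • rotCW (b - a)) (polarVertex b c a) =
        (inner ℝ b (polarVertex b c a) - inner ℝ a (polarVertex b c a)) / t := by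
      simp only [cross, inner_plane, PiLp.smul_apply, rotCW_zero, rotCW_one, smul_eq_mul,
        PiLp.sub_apply]
      ring
    rw [e, h3, h4]
    ring

theorem IsMaxTriangle.support (h : IsMaxTriangle K a b c) (h0 : (0 : Plane) ∈ interior K)
    {y : Plane} (hmin : ∀ x ∈ K, bary c a b y ≤ bary c a b x) :
    (∀ x ∈ K, cross x (b - a) ≤ cross y (b - a)) ∧ 0 < cross y (b - a) := by
  have h1 : ∀ x ∈ K, cross x (b - a) ≤ cross y (b - a) := by
    intro x hx
    rw [cross_sub_eq h.pos.ne', cross_sub_eq h.pos.ne']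
    have := hmin x hx
    have := h.pos
    gcongr
  obtain ⟨x, hx, hpos⟩ := cross_pos_of_interior h0 h.rotate.rotate.ne
  exact ⟨h1, hpos.trans_le (h1 x hx)⟩

theorem IsMaxTriangle.inCone_polarVertex (h : IsMaxTriangle K a b c) (hd₁ : 0 < depth a b c)
    (hd₂ : 0 < depth b c a) {t : ℝ} (ht : 0 < t) :
    InCone (polarVertex a b c) (polarVertex b c a) (t⁻¹ • rotCW (b - a)) := by
  have p1 : 0 < 1 / (2 * depth a b c) := by positivity
  have p2 : 0 < 1 / (2 * depth b c a) := by positivity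
  apply inCone_polar ht (cross_polarVertex h.pos hd₁ hd₂)
  · rw [h.rotate.inner_first hd₂, h.rotate.inner_third hd₂]
    linarith
  · rw [h.inner_first hd₁, h.inner_second hd₁]
    linarith
  · rw [h.rotate.inner_first hd₂, h.rotate.inner_third hd₂, h.inner_first hd₁,
      h.inner_second hd₁]
    linarith

/-- K contains the triangles gay and gyb, and K* contains the triangles from o spanned by the two
polar vertices and the polar of the support line at y. The support value of y cancels in the product
of the two bounds. -/
theorem cornerArea_basic (hK : Convex ℝ K) (h0 : (0 : Plane) ∈ interior K)
    (h : IsMaxTriangle K a b c) (hg : (3 : ℝ) • g = a + b + c) {y : Plane} (hy : y ∈ K)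
    (hmin : ∀ x ∈ K, bary c a b y ≤ bary c a b x) :
    CornerArea K a b c g (cross y (b - a))
      ((1 / (2 * depth a b c) + 1 / (2 * depth b c a)) / cross y (b - a)) := by
  have hd₁ := h.depth_pos h0
  have hd₂ := h.rotate.depth_pos h0
  obtain ⟨hsup, hpos⟩ := h.support h0 hmin
  have hgK := centroid_mem hK h hg
  constructor
  · rw [← cross_sub_add_cross_sub]
    have hy0 : bary c a b y ≤ 0 := (hmin a h.mem₁).trans bary_second.le
    refine ofReal_two_cross_le_sector (convex_translate hK g) (by simpa using hgK)
      (by simpa using h.mem₁) (by simpa using h.mem₂) (by simpa using hy) (h.inCone hg hy hy0)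
  · have e := h.cross_polar hd₁ hd₂ (cross y (b - a))
    rw [add_div, ← e.1, ← e.2]
    exact ofReal_two_cross_le_sector (convex_polarBody K) (zero_mem_polarBody K)
      (h.polarVertex_mem hd₁) (h.rotate.polarVertex_mem hd₂) (rotCW_mem_polarBody hpos hsup)
      (h.inCone_polarVertex hd₁ hd₂ hpos)

/-- On a tie p itself is chosen: the cone lemmas need a support point that is strictly beyond the
line or is its endpoint. -/
theorem exists_support_strict {K : Set Plane} (hK : IsCompact K) (h0 : (0 : Plane) ∈ interior K)
    {p v : Plane} (hp : p ∈ K) (hv : v ≠ 0) :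
    ∃ w ∈ K, 0 < cross w v ∧ (∀ x ∈ K, cross x v ≤ cross w v) ∧
      (w = p ∨ cross p v < cross w v) := by
  obtain ⟨w, hw, hpos, hmax⟩ := exists_support hK h0 hv
  rcases (hmax p hp).eq_or_lt with heq | hlt
  · exact ⟨p, hp, heq ▸ hpos, heq ▸ hmax, Or.inl rfl⟩
  · exact ⟨w, hw, hpos, hmax, Or.inr hlt⟩

/-- Support points w, w' in the normal directions of ay and yb, and the polars of their support
lines, are added to both sectors. With q, r the polar vertices and z the polar of the support line
at y, the gain is (1 - ⟨a,z⟩)((1 - ⟨y,q⟩) + (1 - ⟨y,r⟩)). -/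
theorem exists_cornerArea_refined (hK : Convex ℝ K) (hKc : IsCompact K)
    (h0 : (0 : Plane) ∈ interior K) (h : IsMaxTriangle K a b c)
    (hg : (3 : ℝ) • g = a + b + c) {y : Plane} (hy : y ∈ K)
    (hmin : ∀ x ∈ K, bary c a b y ≤ bary c a b x) (hneg : bary c a b y < 0) :
    ∃ X Y, 0 < X ∧ 0 < Y ∧ CornerArea K a b c g X Y ∧
      1 / (2 * depth a b c) + 1 / (2 * depth b c a) +
        -bary c a b y / (1 - 2 * depth c a b - bary c a b y) *
          ((1 - bary a b c y) / (2 * depth a b c) + (1 - bary b c a y) / (2 * depth b c a)) ≤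
        X * Y := by
  have hd₁ := h.depth_pos h0
  have hd₂ := h.rotate.depth_pos h0
  have hΔ := h.pos
  obtain ⟨hsup, hpos⟩ := h.support h0 hmin
  have hgK := centroid_mem hK h hg
  have hy1 := h.bary_le_one hy
  have hy2 := h.rotate.bary_le_one hy
  have hya : y - a ≠ 0 := by
    intro e
    rw [sub_eq_zero.1 e, bary_second] at hneg
    exact lt_irrefl _ hneg
  have hby : b - y ≠ 0 := by
    intro e
    rw [← sub_eq_zero.1 e, bary_third] at hneg
    exact lt_irrefl _ hneg
  obtain ⟨w, hw, hwpos, hwmax, hwa⟩ := exists_support_strict hKc h0 h.mem₁ hya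
  obtain ⟨w', hw', hwpos', hwmax', hwb⟩ := exists_support_strict hKc h0 h.mem₂ hby
  set q := polarVertex a b c with hq
  set r := polarVertex b c a with hr
  set t := cross y (b - a) with ht
  set z := t⁻¹ • rotCW (b - a) with hz
  have hqK : q ∈ polarBody K := h.polarVertex_mem hd₁
  have hrK : r ∈ polarBody K := h.rotate.polarVertex_mem hd₂
  have hzK : z ∈ polarBody K := rotCW_mem_polarBody hpos hsup
  have hle : ∀ {x v}, x ∈ K → v ∈ polarBody K → inner ℝ x v ≤ 1 := by
    intro x v hx hv
    rw [real_inner_comm]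
    exact hv x hx
  obtain ⟨hqz, hzr⟩ := h.cross_polar hd₁ hd₂ t
  rw [← hz, ← hq] at hqz
  rw [← hz, ← hr] at hzr
  have haq : inner ℝ a q = 1 := h.inner_first hd₁
  have hbr : inner ℝ b r = 1 := h.rotate.inner_first hd₂
  have hyz : inner ℝ y z = 1 := by rw [hz, inner_inv_smul_rotCW, ← ht, div_self hpos.ne']
  have hbaz : inner ℝ b z = inner ℝ a z := by
    rw [hz, inner_inv_smul_rotCW, inner_inv_smul_rotCW]
    congr 1
    simp only [cross, PiLp.sub_apply]
    ring
  have hqz0 : 0 < cross q z := by rw [hqz]; positivity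
  have hzr0 : 0 < cross z r := by rw [hzr]; positivity
  have hyq := hle hy hqK
  have hyr := hle hy hrK
  have haz := hle h.mem₁ hzK
  -- The product is ⟨w,q⟩(1 - ⟨a,z⟩) + ⟨w,z⟩(1 - ⟨y,q⟩), where ⟨w,q⟩ and ⟨w,z⟩ are at most 1.
  have hc₁ : cross w (y - a) * cross q z ≤ (1 - inner ℝ a z) + (1 - inner ℝ y q) := by
    rw [cross_mul_cross, inner_sub_left, inner_sub_left, hyz, haq]
    nlinarith [hle hw hqK, hle hw hzK]
  have hc₂ : cross w' (b - y) * cross z r ≤ (1 - inner ℝ a z) + (1 - inner ℝ y r) := by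
    rw [cross_mul_cross, inner_sub_left, inner_sub_left, hyz, hbr, hbaz]
    nlinarith [hle hw' hrK, hle hw' hzK]
  have hp₁ := mul_pos hwpos hqz0
  have hp₂ := mul_pos hwpos' hzr0
  have hcone₁ : InCone q z ((cross w (y - a))⁻¹ • rotCW (y - a)) := by
    apply inCone_polar hwpos hqz0
    · rw [hyz]; exact haz
    · rw [haq]; exact hyq
    · rw [haq, hyz]; linarith
  have hcone₂ : InCone z r ((cross w' (b - y))⁻¹ • rotCW (b - y)) := by
    apply inCone_polar hwpos' hzr0
    · rw [hbr]; exact hyr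
    · rw [hbaz, hyz]; exact haz
    · rw [hbr, hbaz, hyz]; linarith
  have hB₁ : cross q ((cross w (y - a))⁻¹ • rotCW (y - a)) +
      cross ((cross w (y - a))⁻¹ • rotCW (y - a)) z =
      ((1 - inner ℝ a z) + (1 - inner ℝ y q)) / cross w (y - a) := by
    rw [cross_add_cross_polar, inner_sub_left, inner_sub_left, hyz, haq]
    ring
  have hB₂ : cross z ((cross w' (b - y))⁻¹ • rotCW (b - y)) +
      cross ((cross w' (b - y))⁻¹ • rotCW (b - y)) r =
      ((1 - inner ℝ a z) + (1 - inner ℝ y r)) / cross w' (b - y) := by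
    rw [cross_add_cross_polar, inner_sub_left, inner_sub_left, hyz, hbr, hbaz]
    ring
  have hwcone : InCone (a - g) (y - g) (w - g) := by
    rcases hwa with rfl | hlt
    · exact ⟨1, 0, zero_le_one, le_rfl, by norm_num, by simp⟩
    · refine inCone_left h.pos.ne' hg hneg hy1 (h.bary_le_one hw) (hmin w hw) ?_
      have e : cross (w - a) (y - a) = cross w (y - a) - cross a (y - a) := by
        simp only [cross, PiLp.sub_apply]; ring
      have e' := cross_sub_sub_bary hΔ.ne' w y
      exact pos_of_mul_pos_right (by linarith) hΔ.le
  have hwcone' : InCone (y - g) (b - g) (w' - g) := by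
    rcases hwb with rfl | hlt
    · exact ⟨0, 1, le_rfl, zero_le_one, by norm_num, by simp⟩
    · refine inCone_right h.pos.ne' hg hneg hy2 (h.rotate.bary_le_one hw') (hmin w' hw') ?_
      have e : cross (y - b) (w' - b) = cross w' (b - y) - cross b (b - y) := by
        simp only [cross, PiLp.sub_apply]; ring
      have e' := cross_sub_sub_bary h.rotate.pos.ne' y w'
      rw [area_rotate a b c] at e'
      refine pos_of_mul_pos_right (a := area a b c) ?_ hΔ.le
      linarith
  refine ⟨cross w (y - a) + cross w' (b - y),
    ((1 - inner ℝ a z) + (1 - inner ℝ y q)) / cross w (y - a) +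
      ((1 - inner ℝ a z) + (1 - inner ℝ y r)) / cross w' (b - y), by positivity, ?_, ⟨?_, ?_⟩, ?_⟩
  · have h1 := div_pos (hp₁.trans_le hc₁) hwpos
    have h2 := div_pos (hp₂.trans_le hc₂) hwpos'
    linarith
  · have e : cross w (y - a) + cross w' (b - y) + cross (b - a) g =
        (cross (a - g) (w - g) + cross (w - g) (y - g)) +
          (cross (y - g) (w' - g) + cross (w' - g) (b - g)) := by
      simp only [cross, PiLp.sub_apply]
      ring
    rw [e]
    exact ofReal_four_cross_le_sector (convex_translate hK g) (by simpa using hgK)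
      (by simpa using h.mem₁) (by simpa using h.mem₂) (by simpa using hy) (by simpa using hw)
      (by simpa using hw') (h.inCone hg hy hneg.le) hwcone hwcone'
  · rw [← hB₁, ← hB₂]
    exact ofReal_four_cross_le_sector (convex_polarBody K) (zero_mem_polarBody K) hqK hrK hzK
      (rotCW_mem_polarBody hwpos hwmax) (rotCW_mem_polarBody hwpos' hwmax')
      (h.inCone_polarVertex hd₁ hd₂ hpos) hcone₁ hcone₂
  -- As ⟨y,z⟩ = ⟨a,q⟩ = 1, the gain of the first half factors as (1 - ⟨a,z⟩)(1 - ⟨y,q⟩); similarly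
  -- for the second.
  · have key := mul_add_le_of_sectors hwpos hwpos' hqz0.le hzr0.le (hwmax a h.mem₁)
      (hwmax' y hy) hc₁ hc₂
    refine le_trans (le_of_eq ?_) key
    have e₁ : cross a (y - a) * cross q z = inner ℝ y z * inner ℝ a q - inner ℝ a z * inner ℝ y q := by
      rw [cross_mul_cross, inner_sub_left, inner_sub_left]; ring
    have e₂ : cross y (b - y) * cross z r = inner ℝ y z * inner ℝ b r - inner ℝ b z * inner ℝ y r := by
      rw [cross_mul_cross, inner_sub_left, inner_sub_left]; ring
    have e₃ : cross a (y - a) + cross y (b - y) = t := by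
      rw [ht]; simp only [cross, PiLp.sub_apply]; ring
    have e₄ : t * (cross q z + cross z r) =
        1 / (2 * depth a b c) + 1 / (2 * depth b c a) := by
      rw [hqz, hzr]; field_simp
    have e₅ : 1 - inner ℝ a z = -bary c a b y / (1 - 2 * depth c a b - bary c a b y) := by
      rw [hz, inner_inv_smul_rotCW, ht, cross_sub_eq hΔ.ne', cross_sub_eq hΔ.ne', bary_second]
      have : 1 - 2 * depth c a b - bary c a b y ≠ 0 := by
        intro e
        rw [ht, cross_sub_eq hΔ.ne', e, mul_zero] at hpos
        exact lt_irrefl _ hpos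
      field_simp
      ring
    have e₆ : 1 - inner ℝ y q = (1 - bary a b c y) / (2 * depth a b c) := by
      rw [hq, inner_polarVertex h.pos hd₁]; ring
    have e₇ : 1 - inner ℝ y r = (1 - bary b c a y) / (2 * depth b c a) := by
      rw [hr, inner_polarVertex h.rotate.pos hd₂]; ring
    rw [e₁, e₂, e₃, e₄, ← e₅, ← e₆, ← e₇, hyz, haq, hbr, hbaz]
    ring

end Corner

/-! ### Numerical inequalities -/

section RealInequalities

theorem two_mul_le_add_of_sq_le {X₁ Y₁ X₂ Y₂ c₁ c₂ W : ℝ} (hX₁ : 0 ≤ X₁) (hX₂ : 0 ≤ X₂)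
    (hY₁ : 0 ≤ Y₁) (hY₂ : 0 ≤ Y₂) (hc₁ : 0 ≤ c₁) (hc₂ : 0 ≤ c₂) (h₁ : c₁ ≤ X₁ * Y₁)
    (h₂ : c₂ ≤ X₂ * Y₂) (hW : W ^ 2 ≤ c₁ * c₂) :
    2 * W ≤ X₁ * Y₂ + X₂ * Y₁ := by
  have h3 : c₁ * c₂ ≤ (X₁ * Y₁) * (X₂ * Y₂) := mul_le_mul h₁ h₂ hc₂ (hc₁.trans h₁)
  refine abs_le_of_sq_le_sq' ?_ (by positivity) |>.2
  nlinarith [sq_nonneg (X₁ * Y₂ - X₂ * Y₁)]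

/-- Cauchy–Schwarz in the form (s + p)(s + q) ≥ (s + √(pq))², with the geometric mean of 1/(2x),
1/(2y) bounded below by 1/(x + y) to avoid roots. -/
theorem sq_le_mul_of_weights {x y z : ℝ} (hx : 0 < x) (hy : 0 < y) (hz : 0 < z) :
    (1 / (2 * z) + 1 / (x + y)) ^ 2 ≤
      (1 / (2 * y) + 1 / (2 * z)) * (1 / (2 * z) + 1 / (2 * x)) := by
  have h1 : 2 * (1 / (x + y)) ≤ 1 / (2 * x) + 1 / (2 * y) := by
    rw [← sub_nonneg]
    have : 1 / (2 * x) + 1 / (2 * y) - 2 * (1 / (x + y)) =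
        (x - y) ^ 2 / (2 * x * y * (x + y)) := by field_simp; ring
    rw [this]
    positivity
  have h2 : (1 / (x + y)) ^ 2 ≤ 1 / (2 * x) * (1 / (2 * y)) := by
    rw [← sub_nonneg]
    have : 1 / (2 * x) * (1 / (2 * y)) - (1 / (x + y)) ^ 2 =
        (x - y) ^ 2 / (4 * x * y * (x + y) ^ 2) := by field_simp; ring
    rw [this]
    positivity
  have h3 : 0 < 1 / (2 * z) := by positivity
  nlinarith [mul_le_mul_of_nonneg_left h1 h3.le]

theorem nine_le_sum_inv {x y z : ℝ} (hx : 0 < x) (hy : 0 < y) (hz : 0 < z) (h : x + y + z = 1) :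
    9 ≤ 1 / x + 1 / y + 1 / z := by
  have e : 1 / x + 1 / y + 1 / z = (x + y + z) * (1 / x + 1 / y + 1 / z) := by rw [h, one_mul]
  rw [e, ← sub_nonneg]
  have : (x + y + z) * (1 / x + 1 / y + 1 / z) - 9 =
      (x - y) ^ 2 / (x * y) + (y - z) ^ 2 / (y * z) + (x - z) ^ 2 / (x * z) := by
    field_simp
    ring
  rw [this]
  positivity

/-- The numerical core of the planar inequality for the volume product of polar bodies. -/
theorem volumeProduct_core {x y z G V X₁ X₂ X₃ Y₁ Y₂ Y₃ : ℝ} (hx : 0 < x) (hy : 0 < y)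
    (hz : 0 < z) (h : x + y + z = 1) (hG : 0 ≤ G) (hX₁ : 0 < X₁) (hX₂ : 0 < X₂) (hX₃ : 0 < X₃)
    (hY₁ : 0 < Y₁) (hY₂ : 0 < Y₂) (hY₃ : 0 < Y₃)
    (h₁ : 1 / (2 * y) + 1 / (2 * z) ≤ X₁ * Y₁) (h₂ : 1 / (2 * z) + 1 / (2 * x) ≤ X₂ * Y₂)
    (h₃ : 1 / (2 * x) + 1 / (2 * y) + G ≤ X₃ * Y₃)
    (hV : (X₁ + X₂ + X₃) * (Y₁ + Y₂ + Y₃) ≤ V) :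
    2 * (1 / x + 1 / y + 1 / z) + 9 + G ≤ V := by
  have px : 0 < 1 / (2 * x) := by positivity
  have py : 0 < 1 / (2 * y) := by positivity
  have pz : 0 < 1 / (2 * z) := by positivity
  have w12 := two_mul_le_add_of_sq_le hX₁.le hX₂.le hY₁.le hY₂.le (by positivity) (by positivity)
    h₁ h₂ (sq_le_mul_of_weights hx hy hz)
  have w23 := two_mul_le_add_of_sq_le hX₂.le hX₃.le hY₂.le hY₃.le (by positivity) (by positivity)
    h₂ (show 1 / (2 * x) + 1 / (2 * y) ≤ X₃ * Y₃ by linarith) (sq_le_mul_of_weights hy hz hx)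
  have w31 := two_mul_le_add_of_sq_le hX₃.le hX₁.le hY₃.le hY₁.le (by positivity) (by positivity)
    (show 1 / (2 * x) + 1 / (2 * y) ≤ X₃ * Y₃ by linarith) h₁ (sq_le_mul_of_weights hz hx hy)
  -- The diagonal products give 1/x + 1/y + 1/z + G. The mixed ones give the same sum of reciprocals
  -- again, plus the reciprocals of the three pairwise means, which also have sum 1 and so
  -- contribute 9.
  have h9 := nine_le_sum_inv (x := (x + y) / 2) (y := (y + z) / 2) (z := (z + x) / 2)
    (by positivity) (by positivity) (by positivity) (by linarith)
  have e1 : 1 / ((x + y) / 2) = 2 * (1 / (x + y)) := by field_simp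
  have e2 : 1 / ((y + z) / 2) = 2 * (1 / (y + z)) := by field_simp
  have e3 : 1 / ((z + x) / 2) = 2 * (1 / (z + x)) := by field_simp
  have f1 : 1 / x = 2 * (1 / (2 * x)) := by field_simp
  have f2 : 1 / y = 2 * (1 / (2 * y)) := by field_simp
  have f3 : 1 / z = 2 * (1 / (2 * z)) := by field_simp
  rw [e1, e2, e3] at h9
  rw [f1, f2, f3]
  nlinarith

/-- The bound 9.045 is 9 + 13.5ε at ε = 1/300. Averaging y and z leaves a quadratic inequality in x.
-/
theorem bounds_of_sum_inv_le {x y z : ℝ} (hx : 0 < x) (hy : 0 < y) (hz : 0 < z)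
    (h : x + y + z = 1) (hs : 1 / x + 1 / y + 1 / z ≤ 9.045) : 0.3 ≤ x ∧ x ≤ 0.37 := by
  have h1 : 4 / (y + z) ≤ 1 / y + 1 / z := by
    rw [← sub_nonneg]
    have : 1 / y + 1 / z - 4 / (y + z) = (y - z) ^ 2 / (y * z * (y + z)) := by field_simp; ring
    rw [this]
    positivity
  have e : y + z = 1 - x := by linarith
  have hx1 : 0 < 1 - x := by linarith
  rw [e] at h1
  have h2 : 1 / x + 4 / (1 - x) ≤ 9.045 := by linarith
  have h3 : 1 + 3 * x ≤ 9.045 * (x * (1 - x)) := by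
    have : 1 / x + 4 / (1 - x) = (1 + 3 * x) / (x * (1 - x)) := by field_simp; ring
    rwa [this, div_le_iff₀ (by positivity)] at h2
  constructor
  · nlinarith [sq_nonneg (x - 0.3)]
  · nlinarith [sq_nonneg (x - 0.37)]

/-- Here 1.036 = 1.4 · 0.74, the product of upper bounds for 1 - 2z + n and for 2x, 2y. -/
theorem le_gain {x y z n u v : ℝ} (hx : 0 < x) (hy : 0 < y) (hx' : x ≤ 0.37) (hy' : y ≤ 0.37)
    (hz : 0.3 ≤ z) (hz' : z ≤ 0.37) (hn : 0 ≤ n) (hn' : n ≤ 1) (hu : 0 ≤ u) (hv : 0 ≤ v)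
    (huv : u + v = 1 - n) :
    n * (1 - n) / 1.036 ≤ n / (1 - 2 * z + n) * (u / (2 * x) + v / (2 * y)) := by
  have h1 : n / 1.4 ≤ n / (1 - 2 * z + n) := by
    apply div_le_div_of_nonneg_left hn <;> linarith
  have h2 : u / 0.74 ≤ u / (2 * x) := by
    apply div_le_div_of_nonneg_left hu <;> linarith
  have h3 : v / 0.74 ≤ v / (2 * y) := by
    apply div_le_div_of_nonneg_left hv <;> linarith
  calc n * (1 - n) / 1.036 = n / 1.4 * (u / 0.74 + v / 0.74) := by rw [← huv]; ring
    _ ≤ _ := mul_le_mul h1 (add_le_add h2 h3) (by positivity)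
      (div_nonneg hn (by linarith))

/-- AM-GM for the mixed term X₂Y₃ + X₃Y₂ is far from equality when X₃/X₂ ≥ 2.25, since 2.25 + 1/2.25
> 2.69. The target 27.09 is 27(1 + ε) at ε = 1/300. -/
theorem unbalanced_lt {x y z X₁ X₂ X₃ Y₁ Y₂ Y₃ : ℝ} (hx : 0.3 ≤ x) (hy : 0.3 ≤ y) (hz : 0.3 ≤ z)
    (hx' : x ≤ 0.37) (hy' : y ≤ 0.37) (hz' : z ≤ 0.37) (h : x + y + z = 1)
    (hX₁ : 0 < X₁) (hX₂ : 0 < X₂) (hX₃ : 0 < X₃) (hY₁ : 0 < Y₁) (hY₂ : 0 < Y₂) (hY₃ : 0 < Y₃)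
    (h₁ : 1 / (2 * y) + 1 / (2 * z) ≤ X₁ * Y₁) (h₂ : 1 / (2 * z) + 1 / (2 * x) ≤ X₂ * Y₂)
    (h₃ : 1 / (2 * x) + 1 / (2 * y) ≤ X₃ * Y₃) (h32 : 2.25 * X₂ ≤ X₃) :
    27.09 < (X₁ + X₂ + X₃) * (Y₁ + Y₂ + Y₃) := by
  have hx0 : 0 < x := by linarith
  have hy0 : 0 < y := by linarith
  have hz0 : 0 < z := by linarith
  have w12 := two_mul_le_add_of_sq_le hX₁.le hX₂.le hY₁.le hY₂.le (by positivity) (by positivity)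
    h₁ h₂ (sq_le_mul_of_weights hx0 hy0 hz0)
  have w31 := two_mul_le_add_of_sq_le hX₃.le hX₁.le hY₃.le hY₁.le (by positivity) (by positivity)
    h₃ h₁ (sq_le_mul_of_weights hz0 hx0 hy0)
  have h9 := nine_le_sum_inv hx0 hy0 hz0 h
  have f1 : 1 / x = 2 * (1 / (2 * x)) := by field_simp
  have f2 : 1 / y = 2 * (1 / (2 * y)) := by field_simp
  have f3 : 1 / z = 2 * (1 / (2 * z)) := by field_simp
  rw [f1, f2, f3] at h9
  have g1 : 1.35 ≤ 1 / (2 * y) := by rw [le_div_iff₀ (by positivity)]; linarith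
  have g2 : 1.35 ≤ 1 / (2 * z) := by rw [le_div_iff₀ (by positivity)]; linarith
  have g3 : 1.42 ≤ 1 / (x + y) := by rw [le_div_iff₀ (by positivity)]; linarith
  have g4 : 1.42 ≤ 1 / (z + x) := by rw [le_div_iff₀ (by positivity)]; linarith
  have harm : ∀ s t : ℝ, 0 < s → 0 < t → s + t ≤ 0.7 → 2.85 ≤ 1 / (2 * s) + 1 / (2 * t) := by
    intro s t hs ht hst
    have e : 1 / (2 * s) + 1 / (2 * t) = (s + t) / (2 * (s * t)) := by field_simp; ring
    rw [e, le_div_iff₀ (by positivity)]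
    nlinarith [sq_nonneg (s - t), mul_nonneg (add_pos hs ht).le (sub_nonneg.2 hst)]
  have k2 := (harm z x hz0 hx0 (by linarith)).trans h₂
  have k3 := (harm x y hx0 hy0 (by linarith)).trans h₃
  have k4 : 2.85 * 2.69 ≤ X₂ * Y₃ + X₃ * Y₂ := by
    have l2 : 2.85 / X₂ ≤ Y₂ := by rw [div_le_iff₀ hX₂]; linarith
    have l3 : 2.85 / X₃ ≤ Y₃ := by rw [div_le_iff₀ hX₃]; linarith
    have l4 : X₂ * (2.85 / X₃) + X₃ * (2.85 / X₂) ≤ X₂ * Y₃ + X₃ * Y₂ := by gcongr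
    refine le_trans ?_ l4
    have e : X₂ * (2.85 / X₃) + X₃ * (2.85 / X₂) = 2.85 * (X₂ ^ 2 + X₃ ^ 2) / (X₂ * X₃) := by
      field_simp
    rw [e, le_div_iff₀ (by positivity)]
    nlinarith [mul_nonneg (sub_nonneg.2 h32) (show 0 ≤ X₃ - 0.44 * X₂ by linarith)]
  have e : (X₁ + X₂ + X₃) * (Y₁ + Y₂ + Y₃) = X₁ * Y₁ + X₂ * Y₂ + X₃ * Y₃ +
      (X₁ * Y₂ + X₂ * Y₁) + (X₃ * Y₁ + X₁ * Y₃) + (X₂ * Y₃ + X₃ * Y₂) := by ring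
  rw [e]
  norm_num at k4
  linarith

end RealInequalities

/-! ### Stability: K is close to its maximal triangle -/

section Stability

variable {K : Set Plane} {a b c : Plane} {ε : ℝ}

theorem exists_min_bary (hKc : IsCompact K) (ha : a ∈ K) :
    ∃ y ∈ K, ∀ x ∈ K, bary a b c y ≤ bary a b c x := by
  have hc : Continuous (bary a b c) := by
    unfold bary area cross
    fun_prop
  obtain ⟨y, hy, hmin⟩ := hKc.exists_isMinOn ⟨a, ha⟩ hc.continuousOn
  exact ⟨y, hy, fun x hx => hmin hx⟩

theorem exists_smul_eq (a b c : Plane) : ∃ g : Plane, (3 : ℝ) • g = a + b + c :=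
  ⟨(1 / 3 : ℝ) • (a + b + c), by rw [smul_smul]; norm_num⟩

theorem exists_cornerArea {g : Plane} (hK : Convex ℝ K) (hKc : IsCompact K)
    (h0 : (0 : Plane) ∈ interior K) (h : IsMaxTriangle K a b c)
    (hg : (3 : ℝ) • g = a + b + c) {y : Plane} (hy : y ∈ K)
    (hmin : ∀ x ∈ K, bary c a b y ≤ bary c a b x) :
    ∃ X Y, 0 < X ∧ 0 < Y ∧ CornerArea K a b c g X Y ∧
      1 / (2 * depth a b c) + 1 / (2 * depth b c a) +
        -bary c a b y / (1 - 2 * depth c a b - bary c a b y) *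
          ((1 - bary a b c y) / (2 * depth a b c) + (1 - bary b c a y) / (2 * depth b c a)) ≤
        X * Y := by
  have hd₁ := h.depth_pos h0
  have hd₂ := h.rotate.depth_pos h0
  rcases lt_or_ge (bary c a b y) 0 with hneg | hnn
  · exact exists_cornerArea_refined hK hKc h0 h hg hy hmin hneg
  · have h00 : bary c a b y = 0 := le_antisymm ((hmin a h.mem₁).trans bary_second.le) hnn
    have hpos := (h.support h0 hmin).2
    refine ⟨_, _, hpos, by positivity, cornerArea_basic hK h0 h hg hy hmin, ?_⟩
    rw [h00, mul_div_cancel₀ _ hpos.ne']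
    simp

/-- The height -n satisfies -n(1 + n) < 0.0933, less than 0.11 · 0.89, so it avoids the interval
(0.11, 0.89). On the low branch 1 + n ≥ 0.89 makes the bound linear in ε. -/
theorem small_or_large {n : ℝ} (hε : 0 < ε) (hε' : ε < 1 / 300)
    (h : -n * (1 - -n) / 1.036 ≤ 27 * ε) :
    -300 * ε ≤ n ∧ -0.11 ≤ n ∨ n ≤ -0.89 := by
  rw [div_le_iff₀ (by norm_num)] at h
  by_cases hlow : n ≤ -0.89
  · exact Or.inr hlow
  left
  have hlow' : -0.11 ≤ n := by
    by_contra! hlt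
    nlinarith
  refine ⟨?_, hlow'⟩
  by_contra! hlt
  have hn : 0 ≤ -n := by linarith
  nlinarith [mul_nonneg hn (by linarith : 0 ≤ n + 0.11)]

theorem IsMaxTriangle.depth_bounds_or (hK : Convex ℝ K) (hKc : IsCompact K)
    (h0 : (0 : Plane) ∈ interior K) (hε : 0 < ε) (hε' : ε < 1 / 300)
    (hvol : volume K * volume (polarBody K) ≤ ENNReal.ofReal ((1 + ε) * (27 / 4)))
    (h : IsMaxTriangle K a b c) {y₁ y₂ y₃ : Plane} (hy₁ : y₁ ∈ K) (hy₂ : y₂ ∈ K) (hy₃ : y₃ ∈ K)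
    (hmin₁ : ∀ x ∈ K, bary a b c y₁ ≤ bary a b c x)
    (hmin₂ : ∀ x ∈ K, bary b c a y₂ ≤ bary b c a x)
    (hmin₃ : ∀ x ∈ K, bary c a b y₃ ≤ bary c a b x) :
    (0.3 ≤ depth a b c ∧ depth a b c ≤ 0.37) ∧ (0.3 ≤ depth b c a ∧ depth b c a ≤ 0.37) ∧
    (0.3 ≤ depth c a b ∧ depth c a b ≤ 0.37) ∧
    (-300 * ε ≤ bary c a b y₃ ∧ -0.11 ≤ bary c a b y₃ ∨ bary c a b y₃ ≤ -0.89) := by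
  obtain ⟨g, hg⟩ := exists_smul_eq a b c
  have hd₁ := h.depth_pos h0
  have hd₂ := h.rotate.depth_pos h0
  have hd₃ := h.rotate.rotate.depth_pos h0
  have hsum := depth_sum h.pos.ne'
  have hV : 0 ≤ (1 + ε) * (27 / 4) := by positivity
  have C₁ := cornerArea_basic hK h0 h.rotate (by rw [hg]; abel) hy₁ hmin₁
  have C₂ := cornerArea_basic hK h0 h.rotate.rotate (by rw [hg]; abel) hy₂ hmin₂
  have C₃ := cornerArea_basic hK h0 h hg hy₃ hmin₃
  have p₁ := (h.rotate.support h0 hmin₁).2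
  have p₂ := (h.rotate.rotate.support h0 hmin₂).2
  have p₃ := (h.support h0 hmin₃).2
  obtain ⟨X, Y, hX, hY, C, hXY⟩ := exists_cornerArea hK hKc h0 h hg hy₃ hmin₃
  have hn := h.rotate.rotate.neg_one_le_bary hy₃
  have hn0 : bary c a b y₃ ≤ 0 := (hmin₃ a h.mem₁).trans bary_second.le
  have hu := h.bary_le_one hy₃
  have hv := h.rotate.bary_le_one hy₃
  have hs := bary_sum h.pos.ne' y₃
  have hden : 0 < 1 - 2 * depth c a b - bary c a b y₃ := by
    rw [cross_sub_eq h.pos.ne'] at p₃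
    exact pos_of_mul_pos_right p₃ h.pos.le
  have hG : 0 ≤ -bary c a b y₃ / (1 - 2 * depth c a b - bary c a b y₃) *
      ((1 - bary a b c y₃) / (2 * depth a b c) + (1 - bary b c a y₃) / (2 * depth b c a)) := by
    have e1 : 0 ≤ (1 - bary a b c y₃) / (2 * depth a b c) := div_nonneg (by linarith) (by linarith)
    have e2 : 0 ≤ (1 - bary b c a y₃) / (2 * depth b c a) := div_nonneg (by linarith) (by linarith)
    have e3 : 0 ≤ -bary c a b y₃ / (1 - 2 * depth c a b - bary c a b y₃) :=
      div_nonneg (by linarith) hden.le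
    positivity
  have hprod := mul_le_of_cornerArea C₁ C₂ C (by positivity) hV hvol
  have core := volumeProduct_core hd₁ hd₂ hd₃ hsum hG p₁ p₂ hX (by positivity) (by positivity) hY
    (mul_div_cancel₀ _ p₁.ne').ge (mul_div_cancel₀ _ p₂.ne').ge hXY hprod
  have h9 := nine_le_sum_inv hd₁ hd₂ hd₃ hsum
  have b₁ := bounds_of_sum_inv_le hd₁ hd₂ hd₃ hsum (by linarith)
  have b₂ := bounds_of_sum_inv_le hd₂ hd₃ hd₁ (by linarith) (by linarith)
  have b₃ := bounds_of_sum_inv_le hd₃ hd₁ hd₂ (by linarith) (by linarith)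
  refine ⟨b₁, b₂, b₃, ?_⟩
  have hgain := le_gain hd₁ hd₂ b₁.2 b₂.2 b₃.1 b₃.2 (n := -bary c a b y₃) (by linarith)
    (by linarith) (u := 1 - bary a b c y₃) (v := 1 - bary b c a y₃) (by linarith) (by linarith)
    (by linarith)
  rw [← sub_eq_add_neg] at hgain
  exact small_or_large hε hε' (by linarith)

/-- The gain leaves only very low or very high overhangs beyond ab. A high one is played off against
the overhang beyond ca: if that is low the sectors are unbalanced, and if it is high too, abc is not
maximal. -/
theorem IsMaxTriangle.neg_le_bary (hK : Convex ℝ K) (hKc : IsCompact K)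
    (h0 : (0 : Plane) ∈ interior K) (hε : 0 < ε)
    (hvol : volume K * volume (polarBody K) ≤ ENNReal.ofReal ((1 + ε) * (27 / 4)))
    (h : IsMaxTriangle K a b c) {x : Plane} (hx : x ∈ K) : -300 * ε ≤ bary c a b x := by
  rcases le_or_gt (1 / 300) ε with hε' | hε'
  · have := h.rotate.rotate.neg_one_le_bary hx
    linarith
  obtain ⟨y₁, hy₁, hmin₁⟩ := exists_min_bary (b := b) (c := c) hKc h.mem₁
  obtain ⟨y₂, hy₂, hmin₂⟩ := exists_min_bary (b := c) (c := a) hKc h.mem₂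
  obtain ⟨y₃, hy₃, hmin₃⟩ := exists_min_bary (b := a) (c := b) hKc h.mem₃
  obtain ⟨b₁, b₂, b₃, hlow | hhigh⟩ :=
    h.depth_bounds_or hK hKc h0 hε hε' hvol hy₁ hy₂ hy₃ hmin₁ hmin₂ hmin₃
  · exact hlow.1.trans (hmin₃ x hx)
  exfalso
  obtain ⟨-, -, -, hlow₂ | hhigh₂⟩ := h.rotate.rotate.depth_bounds_or hK hKc h0 hε hε' hvol
    hy₃ hy₁ hy₂ hmin₃ hmin₁ hmin₂
  · obtain ⟨g, hg⟩ := exists_smul_eq a b c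
    have hV : 0 ≤ (1 + ε) * (27 / 4) := by positivity
    have C₁ := cornerArea_basic hK h0 h.rotate (by rw [hg]; abel) hy₁ hmin₁
    have C₂ := cornerArea_basic hK h0 h.rotate.rotate (by rw [hg]; abel) hy₂ hmin₂
    have C₃ := cornerArea_basic hK h0 h hg hy₃ hmin₃
    have p₁ := (h.rotate.support h0 hmin₁).2
    have p₂ := (h.rotate.rotate.support h0 hmin₂).2
    have p₃ := (h.support h0 hmin₃).2
    have hd₁ := h.depth_pos h0
    have hd₂ := h.rotate.depth_pos h0
    have hd₃ := h.rotate.rotate.depth_pos h0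
    have hprod := mul_le_of_cornerArea C₁ C₂ C₃ (by positivity) hV hvol
    have hbig := unbalanced_lt b₁.1 b₂.1 b₃.1 b₁.2 b₂.2 b₃.2 (depth_sum h.pos.ne') p₁ p₂ p₃
      (div_pos (by positivity) p₁) (div_pos (by positivity) p₂) (div_pos (by positivity) p₃)
      (mul_div_cancel₀ _ p₁.ne').ge (mul_div_cancel₀ _ p₂.ne').ge (mul_div_cancel₀ _ p₃.ne').ge
      -- By the depth bounds, X₃ ≥ (1 - 0.74 + 0.89)Δ = 1.15Δ and X₂ ≤ (1 - 0.6 + 0.11)Δ = 0.51Δ,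
      -- where Δ is the doubled area of abc; the ratio exceeds 2.25.
      (by
        rw [cross_sub_eq h.pos.ne', cross_sub_eq h.rotate.rotate.pos.ne', area_rotate b c a,
          area_rotate a b c, mul_left_comm]
        refine mul_le_mul_of_nonneg_left ?_ h.pos.le
        have := hlow₂.2
        have := b₂.1
        have := b₃.2
        linarith)
    linarith
  -- With both overhangs at least 0.89, the triangle b y₂ y₃ has at least 2 · 0.89² > 1 times the
  -- area of abc.
  · have hmax := h.max b h.mem₂ y₂ hy₂ y₃ hy₃
    have e := cross_sub_sub_bary h.rotate.pos.ne' y₂ y₃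
    rw [area_rotate a b c] at e
    have h1 := bary_sum h.pos.ne' y₂
    have h2 := bary_sum h.pos.ne' y₃
    have h3 := h.bary_le_one hy₂
    have h4 := h.rotate.rotate.bary_le_one hy₂
    have h5 := h.bary_le_one hy₃
    have h6 := h.rotate.bary_le_one hy₃
    have hone : bary c a b y₂ * bary a b c y₃ - bary a b c y₂ * bary c a b y₃ ≤ 1 := by
      refine le_of_mul_le_mul_left ?_ h.pos
      rw [← e, mul_one]
      exact hmax
    have h7 : 0.89 * 0.89 ≤ bary c a b y₂ * bary a b c y₃ :=
      mul_le_mul (by linarith) (by linarith) (by norm_num) (by linarith)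
    have h8 : 0.89 * 0.89 ≤ bary a b c y₂ * -bary c a b y₃ :=
      mul_le_mul (by linarith) (by linarith) (by norm_num) (by linarith)
    norm_num at h7 h8
    linarith

end Stability

/-! ### The Banach–Mazur distance from a triangle -/

section BanachMazur

theorem linearIndependent_of_cross_ne_zero {u v : Plane} (h : cross u v ≠ 0) :
    LinearIndependent ℝ ![u, v] := by
  rw [LinearIndependent.pair_iff]
  intro s t hst
  have h0 := congrArg (fun x : Plane => x 0) hst
  have h1 := congrArg (fun x : Plane => x 1) hst
  simp only [PiLp.add_apply, PiLp.smul_apply, smul_eq_mul, PiLp.zero_apply] at h0 h1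
  constructor
  · refine (mul_eq_zero.1 ?_).resolve_right h
    simp only [cross]
    linear_combination v 1 * h0 - v 0 * h1
  · refine (mul_eq_zero.1 ?_).resolve_right h
    simp only [cross]
    linear_combination u 0 * h1 - u 1 * h0

theorem area_ne_zero_of_affineIndependent {p : Fin 3 → Plane} (hp : AffineIndependent ℝ p) :
    area (p 0) (p 1) (p 2) ≠ 0 := by
  intro h
  have hli : LinearIndependent ℝ ![p 1 - p 0, p 2 - p 0] := by
    have h := (affineIndependent_iff_linearIndependent_vsub ℝ p 0).1 hp
    have h' := h.comp (![⟨1, by decide⟩, ⟨2, by decide⟩] : Fin 2 → {x : Fin 3 // x ≠ 0})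
      (by intro i j; fin_cases i <;> fin_cases j <;> simp)
    have e : ![p 1 - p 0, p 2 - p 0] = (fun i : {x : Fin 3 // x ≠ 0} => (p i -ᵥ p 0 : Plane)) ∘
        (![⟨1, by decide⟩, ⟨2, by decide⟩] : Fin 2 → {x : Fin 3 // x ≠ 0}) := by
      ext i : 1
      fin_cases i <;> rfl
    rw [e]
    exact h'
  rw [LinearIndependent.pair_iff] at hli
  simp only [area, cross] at h
  have hz : ∀ i : Fin 2, (p 1 - p 0) i = 0 := by
    intro i
    have := hli ((p 2 - p 0) i) (-(p 1 - p 0) i) (by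
      fin_cases i <;> apply plane_ext <;> simp at h ⊢ <;> linarith)
    linarith [this.2]
  have := hli 1 0 (by apply plane_ext <;> simp [-PiLp.sub_apply, hz])
  exact one_ne_zero this.1

theorem mem_closedInterior_iff (T : Affine.Triangle ℝ Plane) (x : Plane) :
    x ∈ T.closedInterior ↔ ∃ t₀ t₁ t₂ : ℝ, 0 ≤ t₀ ∧ 0 ≤ t₁ ∧ 0 ≤ t₂ ∧ t₀ + t₁ + t₂ = 1 ∧
      x = t₀ • T.points 0 + t₁ • T.points 1 + t₂ • T.points 2 := by
  constructor
  · rintro ⟨w, hs, hw, rfl⟩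
    rw [Finset.affineCombination_eq_linear_combination _ _ _ hs]
    exact ⟨w 0, w 1, w 2, (hw 0).1, (hw 1).1, (hw 2).1, (Fin.sum_univ_three w).symm.trans hs,
      Fin.sum_univ_three _⟩
  · rintro ⟨t₀, t₁, t₂, h₀, h₁, h₂, hs, rfl⟩
    have := (convex_convexHull ℝ (Set.range T.points)).sum_mem (t := Finset.univ)
      (w := ![t₀, t₁, t₂]) (z := T.points) (by intro i _; fin_cases i <;> assumption)
      (by simpa [Fin.sum_univ_three] using hs)
      (fun i _ => subset_convexHull ℝ _ (Set.mem_range_self i))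
    rw [← Affine.Simplex.convexHull_eq_closedInterior]
    simpa [Fin.sum_univ_three] using this

theorem exists_affineEquiv {a b c p q r : Plane} (h : area a b c ≠ 0) (h' : area p q r ≠ 0) :
    ∃ A : Plane ≃ᵃ[ℝ] Plane, ∀ s t : ℝ, A (a + s • (b - a) + t • (c - a)) =
      p + s • (q - p) + t • (r - p) := by
  let B := basisOfLinearIndependentOfCardEqFinrank (linearIndependent_of_cross_ne_zero h) (by simp)
  let B' := basisOfLinearIndependentOfCardEqFinrank (linearIndependent_of_cross_ne_zero h')
    (by simp)
  let L : Plane ≃ₗ[ℝ] Plane := B.equiv B' (Equiv.refl _)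
  have h0 : L (b - a) = q - p := by
    have := B.equiv_apply 0 B' (Equiv.refl _)
    simpa [B, B'] using this
  have h1 : L (c - a) = r - p := by
    have := B.equiv_apply 1 B' (Equiv.refl _)
    simpa [B, B'] using this
  refine ⟨L.toAffineEquiv.trans (AffineEquiv.constVAdd ℝ Plane (p - L a)), fun s t => ?_⟩
  simp only [AffineEquiv.trans_apply, LinearEquiv.coe_toAffineEquiv, AffineEquiv.constVAdd_apply,
    vadd_eq_add, map_add, map_smul, h0, h1]
  abel

/-- The triangle where all barycentric coordinates are at least -n contains K and is abc enlarged 1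
+ 3n times about its centroid. The affinity A takes it to T, hence abc to T shrunk by 1 + 3n, with
vertices P, Q, R. -/
theorem mem_banachMazurRatios {K : Set Plane} (hK : Convex ℝ K) {a b c : Plane} (ha : a ∈ K)
    (hb : b ∈ K) (hc : c ∈ K) (h : area a b c ≠ 0) {n : ℝ} (hn : 0 ≤ n)
    (h₁ : ∀ x ∈ K, -n ≤ bary a b c x) (h₂ : ∀ x ∈ K, -n ≤ bary b c a x)
    (h₃ : ∀ x ∈ K, -n ≤ bary c a b x) (T : Affine.Triangle ℝ Plane) :
    1 + 3 * n ∈ banachMazurRatios K T.closedInterior := by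
  set p := T.points 0 with hp
  set q := T.points 1 with hq
  set r := T.points 2 with hr
  have hT : area p q r ≠ 0 := area_ne_zero_of_affineIndependent T.independent
  have hR : 0 < 1 + 3 * n := by positivity
  set P := (1 + 3 * n)⁻¹ • ((1 + n) • p + n • q + n • r) with hP
  set Q := (1 + 3 * n)⁻¹ • (n • p + (1 + n) • q + n • r) with hQ
  set R := (1 + 3 * n)⁻¹ • (n • p + n • q + (1 + n) • r) with hR'
  have hPQR : area P Q R ≠ 0 := by
    have : area P Q R = (1 + 3 * n)⁻¹ ^ 2 * area p q r := by
      simp only [hP, hQ, hR', area, cross, PiLp.sub_apply, PiLp.smul_apply, PiLp.add_apply,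
        smul_eq_mul]
      ring
    rw [this]
    positivity
  obtain ⟨A, hA⟩ := exists_affineEquiv h hPQR
  have hA' : ∀ t₀ t₁ t₂ : ℝ, t₀ + t₁ + t₂ = 1 → A (t₀ • a + t₁ • b + t₂ • c) =
      ((t₀ + n) / (1 + 3 * n)) • p + ((t₁ + n) / (1 + 3 * n)) • q +
        ((t₂ + n) / (1 + 3 * n)) • r := by
    intro t₀ t₁ t₂ ht
    have e : t₀ • a + t₁ • b + t₂ • c = a + t₁ • (b - a) + t₂ • (c - a) := by
      obtain rfl : t₀ = 1 - t₁ - t₂ := by linarith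
      module
    rw [e, hA]
    obtain rfl : t₀ = 1 - t₁ - t₂ := by linarith
    simp only [hP, hQ, hR']
    match_scalars <;> field_simp <;> ring
  refine ⟨1, 1 + 3 * n, one_pos, hR, A, -(n • (p + q + r)), ?_, ?_, by simp⟩
  · rw [one_smul]
    rintro _ ⟨x, hx, rfl⟩
    rw [mem_closedInterior_iff]
    have e1 := h₁ x hx
    have e2 := h₂ x hx
    have e3 := h₃ x hx
    have hs := bary_sum h x
    refine ⟨(bary a b c x + n) / (1 + 3 * n), (bary b c a x + n) / (1 + 3 * n),
      (bary c a b x + n) / (1 + 3 * n), div_nonneg (by linarith) hR.le,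
      div_nonneg (by linarith) hR.le, div_nonneg (by linarith) hR.le, ?_, ?_⟩
    · field_simp
      linarith
    · conv_lhs => rw [bary_combination h x]
      exact hA' _ _ _ hs
  · intro x hx
    obtain ⟨t₀, t₁, t₂, g₀, g₁, g₂, hs, rfl⟩ := (mem_closedInterior_iff T x).1 hx
    rw [Set.mem_add]
    refine ⟨(1 + 3 * n) • A (t₀ • a + t₁ • b + t₂ • c), ⟨_, ⟨_, ?_, rfl⟩, rfl⟩, _, rfl, ?_⟩
    · have := hK.sum_mem (t := Finset.univ) (w := ![t₀, t₁, t₂]) (z := ![a, b, c])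
        (by intro i _; fin_cases i <;> assumption) (by simpa [Fin.sum_univ_three] using hs)
        (by intro i _; fin_cases i <;> assumption)
      simpa [Fin.sum_univ_three] using this
    · rw [hA' _ _ _ hs]
      match_scalars <;> field_simp <;> ring

theorem banachMazurDist_triangle_le {K : Set Plane} (hK : Convex ℝ K) (hKc : IsCompact K)
    (h0 : (0 : Plane) ∈ interior K) {ε : ℝ} (hε : 0 < ε)
    (hvol : volume K * volume (polarBody K) ≤ ENNReal.ofReal ((1 + ε) * (27 / 4)))
    (T : Affine.Triangle ℝ Plane) : banachMazurDist K T.closedInterior ≤ 1 + 900 * ε := by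
  obtain ⟨a, b, c, h⟩ := exists_isMaxTriangle hKc h0
  have hmem := mem_banachMazurRatios hK h.mem₁ h.mem₂ h.mem₃ h.pos.ne' (n := 300 * ε)
    (by positivity)
    (fun x hx => by linarith [h.rotate.neg_le_bary hK hKc h0 hε hvol hx])
    (fun x hx => by linarith [h.rotate.rotate.neg_le_bary hK hKc h0 hε hvol hx])
    (fun x hx => by linarith [h.neg_le_bary hK hKc h0 hε hvol hx]) T
  have hbdd : BddBelow (banachMazurRatios K T.closedInterior) := by
    refine ⟨0, ?_⟩
    rintro _ ⟨l₁, l₂, h₁, h₂, -, -, -, -, rfl⟩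
    positivity
  refine (csInf_le hbdd hmem).trans (le_of_eq ?_)
  ring

end BanachMazur

/-! ### Position of the centre of the intermediate triangle -/

section Centre

theorem bary_combo {a b c : Plane} (h : area a b c ≠ 0) {s t u : ℝ} (hs : s + t + u = 1) :
    bary a b c (s • a + t • b + u • c) = s := by
  obtain rfl : s = 1 - t - u := by linarith
  rw [bary, div_eq_iff h]
  simp [area, cross]
  ring

theorem bary_swap (a b c x : Plane) : bary a c b x = bary a b c x := by
  have e : ∀ x, area x c b = -area x b c := by
    intro x
    simp only [area, cross, PiLp.sub_apply]
    ring
  rw [bary, bary, e, e, neg_div_neg_eq]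

theorem ofReal_area_le_volume {K : Set Plane} (hK : Convex ℝ K) {a b c : Plane} (ha : a ∈ K)
    (hb : b ∈ K) (hc : c ∈ K) : ENNReal.ofReal (area a b c / 2) ≤ volume K := by
  have eK : volume {x | x + a ∈ K} = volume K := measure_preimage_add_right volume a K
  rw [← eK]
  refine (ofReal_cross_le_sector (convex_translate hK a) (by simpa using ha)
    (u := b - a) (v := c - a) (by simpa using hb) (by simpa using hc)).trans ?_
  exact (measure_mono (Set.subset_univ _)).trans (by simp)

theorem cross_pos_of_bary_nonneg {K : Set Plane} (h0 : (0 : Plane) ∈ interior K) {a b c : Plane}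
    (h : 0 < area a b c) (hb : ∀ x ∈ K, 0 ≤ bary a b c x) :
    (∀ x ∈ K, cross x (c - b) ≤ cross b c) ∧ 0 < cross b c := by
  have h1 : ∀ x ∈ K, cross x (c - b) ≤ cross b c := by
    intro x hx
    have h1 := hb x hx
    rw [bary, le_div_iff₀ h, zero_mul, area_eq_cross_sub] at h1
    linarith
  have hne : c - b ≠ 0 := by
    intro e
    rw [sub_eq_zero.1 e] at h
    simp only [area, cross, PiLp.sub_apply] at h
    linarith
  obtain ⟨x, hx, hpos⟩ := cross_pos_of_interior h0 hne
  exact ⟨h1, hpos.trans_le (h1 x hx)⟩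

theorem cross_smul_rotCW_smul_rotCW (s t : ℝ) (u v : Plane) :
    cross (s • rotCW u) (t • rotCW v) = s * t * cross u v := by
  simp only [cross, PiLp.smul_apply, rotCW_zero, rotCW_one, smul_eq_mul]
  ring

/-- The volume product bounds the ratio of the areas of two triangles between which `K` lies. -/
theorem area_le_of_between_of_pos {K : Set Plane} (hK : Convex ℝ K)
    (h0 : (0 : Plane) ∈ interior K) {V : ℝ} (hV : 0 ≤ V)
    (hvol : volume K * volume (polarBody K) ≤ ENNReal.ofReal V) {a b c P Q R : Plane} (ha : a ∈ K)
    (hb : b ∈ K) (hc : c ∈ K) (h : 0 < area P Q R) (habc : 0 ≤ area a b c)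
    (h₁ : ∀ x ∈ K, 0 ≤ bary P Q R x) (h₂ : ∀ x ∈ K, 0 ≤ bary Q R P x)
    (h₃ : ∀ x ∈ K, 0 ≤ bary R P Q x) :
    0 < bary P Q R 0 ∧ 0 < bary Q R P 0 ∧ 0 < bary R P Q 0 ∧
    area a b c ≤ area P Q R * (4 * V * (bary P Q R 0 * bary Q R P 0 * bary R P Q 0)) := by
  have hr₁ := area_rotate P Q R
  have hr₂ := (area_rotate Q R P).trans hr₁
  obtain ⟨s₁, p₁⟩ := cross_pos_of_bary_nonneg h0 h h₁
  obtain ⟨s₂, p₂⟩ := cross_pos_of_bary_nonneg h0 (by rwa [hr₁]) h₂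
  obtain ⟨s₃, p₃⟩ := cross_pos_of_bary_nonneg h0 (by rwa [hr₂]) h₃
  have e₁ : bary P Q R 0 = cross Q R / area P Q R := by simp [bary, area]
  have e₂ : bary Q R P 0 = cross R P / area P Q R := by rw [← hr₁]; simp [bary, area]
  have e₃ : bary R P Q 0 = cross P Q / area P Q R := by rw [← hr₂]; simp [bary, area]
  rw [e₁, e₂, e₃]
  refine ⟨by positivity, by positivity, by positivity, ?_⟩
  -- The polars of the three side lines are the vertices of the polar triangle of PQR, which lies in
  -- K* because K lies in PQR.
  set q₁ := (cross Q R)⁻¹ • rotCW (R - Q)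
  set q₂ := (cross R P)⁻¹ • rotCW (P - R)
  set q₃ := (cross P Q)⁻¹ • rotCW (Q - P)
  have m₁ : q₁ ∈ polarBody K := rotCW_mem_polarBody p₁ s₁
  have m₂ : q₂ ∈ polarBody K := rotCW_mem_polarBody p₂ s₂
  have m₃ : q₃ ∈ polarBody K := rotCW_mem_polarBody p₃ s₃
  have hc := convex_polarBody K
  have hz := zero_mem_polarBody K
  have hpol := ofReal_add_le_volume (ofReal_cross_le_sector hc hz m₁ m₂)
    (ofReal_cross_le_sector hc hz m₂ m₃) (ofReal_cross_le_sector hc hz m₃ m₁)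
  have e : cross q₁ q₂ + cross q₂ q₃ + cross q₃ q₁ =
      area P Q R ^ 2 / (cross Q R * cross R P * cross P Q) := by
    have c₁ : cross q₁ q₂ = area P Q R / (cross Q R * cross R P) := by
      rw [cross_smul_rotCW_smul_rotCW, show cross (R - Q) (P - R) = area P Q R by
        simp only [area, cross, PiLp.sub_apply]; ring]
      field_simp
    have c₂ : cross q₂ q₃ = area P Q R / (cross R P * cross P Q) := by
      rw [cross_smul_rotCW_smul_rotCW, show cross (P - R) (Q - P) = area P Q R by
        simp only [area, cross, PiLp.sub_apply]; ring]
      field_simp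
    have c₃ : cross q₃ q₁ = area P Q R / (cross P Q * cross Q R) := by
      rw [cross_smul_rotCW_smul_rotCW, show cross (Q - P) (R - Q) = area P Q R by
        simp only [area, cross, PiLp.sub_apply]; ring]
      field_simp
    have hs : area P Q R = cross Q R + cross R P + cross P Q := by
      simp only [area, cross, PiLp.sub_apply]; ring
    rw [c₁, c₂, c₃]
    have : cross Q R + cross R P + cross P Q ≠ 0 := by positivity
    rw [hs]
    field_simp
    ring
  rw [e] at hpol
  have := (mul_le_mul' (ofReal_area_le_volume hK ha hb ‹c ∈ K›) hpol).trans hvol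
  rw [← ENNReal.ofReal_mul (by linarith), ENNReal.ofReal_le_ofReal_iff hV] at this
  have h4 : area a b c * area P Q R ^ 2 / (cross Q R * cross R P * cross P Q) ≤ 4 * V := by
    calc _ = 4 * (area a b c / 2 *
        (area P Q R ^ 2 / (cross Q R * cross R P * cross P Q) / 2)) := by ring
      _ ≤ _ := by linarith
  rw [div_le_iff₀ (by positivity)] at h4
  have e' : area P Q R * (4 * V * (cross Q R / area P Q R * (cross R P / area P Q R) *
      (cross P Q / area P Q R))) = 4 * V * (cross Q R * cross R P * cross P Q) /
        area P Q R ^ 2 := by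
    field_simp
  rw [e', le_div_iff₀ (by positivity)]
  exact h4

theorem area_le_of_between {K : Set Plane} (hK : Convex ℝ K)
    (h0 : (0 : Plane) ∈ interior K) {V ρ : ℝ} (hV : 0 ≤ V)
    (hvol : volume K * volume (polarBody K) ≤ ENNReal.ofReal V) {a b c P Q R : Plane} (ha : a ∈ K)
    (hb : b ∈ K) (hc : c ∈ K) (h : area P Q R ≠ 0)
    (habc : area a b c = ρ ^ 2 * area P Q R)
    (h₁ : ∀ x ∈ K, 0 ≤ bary P Q R x) (h₂ : ∀ x ∈ K, 0 ≤ bary Q R P x)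
    (h₃ : ∀ x ∈ K, 0 ≤ bary R P Q x) :
    0 < bary P Q R 0 ∧ 0 < bary Q R P 0 ∧ 0 < bary R P Q 0 ∧
    ρ ^ 2 ≤ 4 * V * (bary P Q R 0 * bary Q R P 0 * bary R P Q 0) := by
  have hsw : ∀ x y z : Plane, area x z y = -area x y z := by
    intro x y z
    simp only [area, cross, PiLp.sub_apply]
    ring
  rcases lt_or_gt_of_ne h with hneg | hpos
  · have hpos : 0 < area P R Q := by rw [hsw]; linarith
    have habc' : area a c b = ρ ^ 2 * area P R Q := by rw [hsw a b c, hsw P Q R, habc]; ring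
    obtain ⟨p₁, p₃, p₂, hle⟩ := area_le_of_between_of_pos hK h0 hV hvol ha hc hb hpos
      (by rw [habc']; positivity) (by simpa only [bary_swap P Q R] using h₁)
      (by simpa only [bary_swap R P Q] using h₃) (by simpa only [bary_swap Q R P] using h₂)
    rw [bary_swap P Q R] at p₁ hle
    rw [bary_swap R P Q] at p₃ hle
    rw [bary_swap Q R P] at p₂ hle
    refine ⟨p₁, p₂, p₃, le_of_mul_le_mul_left ?_ hpos⟩
    calc area P R Q * ρ ^ 2 = area a c b := by rw [habc']; ring
      _ ≤ _ := hle
      _ = _ := by ring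
  · obtain ⟨p₁, p₂, p₃, hle⟩ := area_le_of_between_of_pos hK h0 hV hvol ha hb hc hpos
      (by rw [habc]; positivity) h₁ h₂ h₃
    refine ⟨p₁, p₂, p₃, le_of_mul_le_mul_left ?_ hpos⟩
    calc area P Q R * ρ ^ 2 = area a b c := by rw [habc]; ring
      _ ≤ _ := hle

/-- Stability of AM-GM: 3xyz(x + y + z) ≤ (xy + yz + zx)² gives 27xyz ≤ (1 - 3S/2)² ≤ 1 - 3S/2,
while xyz is nearly 1/27. -/
theorem variance_le {x y z ρ ε : ℝ} (hx : 0 < x) (hy : 0 < y) (hz : 0 < z) (h : x + y + z = 1)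
    (hρ : 0 < ρ) (hε : 0 < ε) (hε' : 1 + 900 * ε < 4) (hρε : 1 / ρ ≤ 1 + 900 * ε)
    (hle : ρ ^ 2 ≤ 4 * ((1 + ε) * (27 / 4)) * (x * y * z)) :
    (x - 1 / 3) ^ 2 + (y - 1 / 3) ^ 2 + (z - 1 / 3) ^ 2 ≤ 3011 * ε := by
  set S := (x - 1 / 3) ^ 2 + (y - 1 / 3) ^ 2 + (z - 1 / 3) ^ 2 with hS
  have hq : x * y + y * z + z * x = 1 / 3 - S / 2 := by
    rw [hS]
    obtain rfl : x = 1 - y - z := by linarith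
    ring
  have hxyz : 27 * (x * y * z) ≤ (1 - 3 / 2 * S) ^ 2 := by
    have : 3 * (x * y * z) ≤ (x * y + y * z + z * x) ^ 2 := by
      have e : 3 * (x * y * z) = 3 * (x * y * z) * (x + y + z) := by rw [h, mul_one]
      rw [e]
      nlinarith [sq_nonneg (x * y - y * z), sq_nonneg (y * z - z * x), sq_nonneg (z * x - x * y)]
    rw [hq] at this
    have e : (1 - 3 / 2 * S) ^ 2 = 9 * (1 / 3 - S / 2) ^ 2 := by ring
    linarith
  have hS0 : 0 ≤ S := by positivity
  clear_value S
  have hS1 : 0 ≤ 1 - 3 / 2 * S := by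
    have : 0 ≤ x * y + y * z + z * x := by positivity
    linarith
  have h1 : ρ ^ 2 ≤ (1 + ε) * (1 - 3 / 2 * S) := by
    have : (1 - 3 / 2 * S) ^ 2 ≤ 1 - 3 / 2 * S := by nlinarith
    calc ρ ^ 2 ≤ (1 + ε) * (27 * (x * y * z)) := by linarith
      _ ≤ _ := mul_le_mul_of_nonneg_left (hxyz.trans this) (by linarith)
  have h2 : 1 ≤ (1 + 900 * ε) * ρ := by rwa [div_le_iff₀ hρ] at hρε
  have h3 : 1 ≤ (1 + 900 * ε) ^ 2 * ρ ^ 2 := by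
    rw [← mul_pow]
    exact one_le_pow₀ h2
  -- Since ε < 1/300, the linear coefficient is 1801 + 811800/300 + 810000/90000 = 4516; two thirds
  -- of it round up to 3011.
  have h4 : (1 + 900 * ε) ^ 2 * (1 + ε) ≤ 1 + 4516 * ε := by
    have e2 : ε ^ 2 ≤ ε / 300 := by nlinarith
    have e3 : ε ^ 3 ≤ ε / 90000 := by nlinarith
    calc (1 + 900 * ε) ^ 2 * (1 + ε) = 1 + 1801 * ε + 811800 * ε ^ 2 + 810000 * ε ^ 3 := by ring
      _ ≤ _ := by linarith
  have h5 : 1 ≤ (1 + 4516 * ε) * (1 - 3 / 2 * S) := by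
    calc (1 : ℝ) ≤ (1 + 900 * ε) ^ 2 * ρ ^ 2 := h3
      _ ≤ (1 + 900 * ε) ^ 2 * ((1 + ε) * (1 - 3 / 2 * S)) := by gcongr
      _ = (1 + 900 * ε) ^ 2 * (1 + ε) * (1 - 3 / 2 * S) := by ring
      _ ≤ _ := by gcongr
  nlinarith [mul_nonneg hε.le hS0]

theorem eisenstein_add_le (A B D E : ℝ) :
    (A + D) * (A + D) + (A + D) * (B + E) + (B + E) * (B + E) ≤
      2 * (A * A + A * B + B * B) + 2 * (D * D + D * E + E * E) := by
  nlinarith [sq_nonneg (A - D + (B - E)), sq_nonneg (A - D), sq_nonneg (B - E)]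

/-- The left side is a quarter of the sum of the squared deviations of the gᵢ from their mean. -/
theorem eisenstein_le_sq {g₁ g₂ g₃ : ℝ} (hg₁ : 0 ≤ g₁) (hg₂ : 0 ≤ g₂) (hg₃ : 0 ≤ g₃) :
    2 * ((g₂ - (g₁ + g₂ + g₃) / 3) / 2 * ((g₂ - (g₁ + g₂ + g₃) / 3) / 2) +
      (g₂ - (g₁ + g₂ + g₃) / 3) / 2 * ((g₃ - (g₁ + g₂ + g₃) / 3) / 2) +
      (g₃ - (g₁ + g₂ + g₃) / 3) / 2 * ((g₃ - (g₁ + g₂ + g₃) / 3) / 2)) ≤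
      (g₁ + g₂ + g₃) ^ 2 := by
  nlinarith [mul_nonneg hg₁ hg₂, mul_nonneg hg₂ hg₃, mul_nonneg hg₁ hg₃, sq_nonneg g₁,
    sq_nonneg g₂, sq_nonneg g₃, sq_nonneg (g₁ + g₂ + g₃)]

/-- The form of the sum is at most S + (1 - ρ)² ≤ 3911ε, and κ² ≤ 4; the constant 917² leaves ample
room. -/
theorem quadraticForm_le {x y z g₁ g₂ g₃ ρ κ ε : ℝ} (hg₁ : 0 ≤ g₁) (hg₂ : 0 ≤ g₂) (hg₃ : 0 ≤ g₃)
    (hg : g₁ + g₂ + g₃ = 1 - ρ) (h : x + y + z = 1) (hκ : 0 ≤ κ) (hκ' : κ ≤ 2)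
    (hρ0 : 0 ≤ ρ) (hρ : 1 - ρ ≤ 900 * ε)
    (hS : (x - 1 / 3) ^ 2 + (y - 1 / 3) ^ 2 + (z - 1 / 3) ^ 2 ≤ 3011 * ε)
    {s t : ℝ} (hs : s = κ * ((1 / 3 - y) + (g₂ - (1 - ρ) / 3) / 2))
    (ht : t = κ * ((1 / 3 - z) + (g₃ - (1 - ρ) / 3) / 2)) :
    s * s + s * t + t * t ≤ 917 ^ 2 * ε := by
  have hpar := eisenstein_add_le (1 / 3 - y) (1 / 3 - z) ((g₂ - (1 - ρ) / 3) / 2)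
    ((g₃ - (1 - ρ) / 3) / 2)
  have e₁ : 2 * ((1 / 3 - y) * (1 / 3 - y) + (1 / 3 - y) * (1 / 3 - z) +
      (1 / 3 - z) * (1 / 3 - z)) = (x - 1 / 3) ^ 2 + (y - 1 / 3) ^ 2 + (z - 1 / 3) ^ 2 := by
    obtain rfl : x = 1 - y - z := by linarith
    ring
  have e₂ := eisenstein_le_sq hg₁ hg₂ hg₃
  rw [hg] at e₂
  have e₃ : (1 - ρ) ^ 2 ≤ 900 * ε := by
    have : 0 ≤ 1 - ρ := by linarith
    have : (1 - ρ) * (1 - ρ) ≤ (1 - ρ) * 1 := mul_le_mul_of_nonneg_left (by linarith) this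
    linarith
  rw [e₁] at hpar
  have hε : 0 ≤ ε := by linarith [sq_nonneg (1 - ρ)]
  have hκ2 : κ ^ 2 ≤ 4 := by nlinarith
  generalize (1 / 3 - y) + (g₂ - (1 - ρ) / 3) / 2 = u at *
  generalize (1 / 3 - z) + (g₃ - (1 - ρ) / 3) / 2 = v at *
  have hb : u * u + u * v + v * v ≤ 3911 * ε := by linarith
  have h1 : s * s + s * t + t * t = κ ^ 2 * (u * u + u * v + v * v) := by rw [hs, ht]; ring
  rw [h1]
  calc κ ^ 2 * (u * u + u * v + v * v) ≤ κ ^ 2 * (3911 * ε) := by gcongr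
    _ ≤ 4 * (3911 * ε) := by gcongr
    _ ≤ _ := by linarith

/-- Polarization: three unit sides force the polar form of the two edge vectors to be 1. -/
theorem IsUnitRegularNorm.sq {p : Fin 3 → Plane} {N : Plane → ℝ} (hN : IsUnitRegularNorm p N)
    (s t : ℝ) : N (s • (p 1 - p 0) + t • (p 2 - p 0)) = √(s * s + s * t + t * t) := by
  obtain ⟨⟨Q, -, hQ⟩, hside⟩ := hN
  have h1 : ∀ i j, i ≠ j → Q (p i - p j) = 1 := by
    intro i j hij
    have := hside i j hij
    rwa [hQ, Real.sqrt_eq_one] at this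
  have e1 := h1 1 0 (by decide)
  have e2 := h1 2 0 (by decide)
  have e3 := h1 1 2 (by decide)
  rw [show p 1 - p 2 = (p 1 - p 0) + -(p 2 - p 0) by abel, QuadraticMap.map_add Q,
    QuadraticMap.map_neg, QuadraticMap.polar_neg_right, e1, e2] at e3
  have e4 : QuadraticMap.polar Q (p 1 - p 0) (p 2 - p 0) = 1 := by linarith
  rw [hQ]
  congr 1
  rw [QuadraticMap.map_add Q, QuadraticMap.map_smul, QuadraticMap.map_smul,
    QuadraticMap.polar_smul_left, QuadraticMap.polar_smul_right, e1, e2, e4]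
  simp only [smul_eq_mul]
  ring

end Centre

theorem centroid_fin_three (f : Fin 3 → Plane) :
    Finset.univ.centroid ℝ f = (1 / 3 : ℝ) • (f 0 + f 1 + f 2) := by
  rw [Finset.centroid_def, Finset.affineCombination_eq_linear_combination _ _ _
    (Finset.sum_centroidWeights_eq_one_of_nonempty ℝ _ Finset.univ_nonempty)]
  simp [Fin.sum_univ_three, Finset.centroidWeights_apply, smul_add]

/-- Eliminating x by `hb0` and adding a multiple of `hg0` gives the centre as l₂ times the
combination of p, q, r with coefficients (1/3 - bᵢ) + (1 - l₁/l₂)(gᵢ - 1/3)/2. These sum to zero, so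
edge vectors suffice; 2l₂/(l₁ + l₂) rescales to the edges of the intermediate triangle. -/
theorem centre_eq {p q r x : Plane} {l₁ l₂ b₁ b₂ b₃ g₁ g₂ g₃ : ℝ} (h₁ : 0 < l₁) (h₂ : 0 < l₂)
    (hb : b₁ + b₂ + b₃ = 1) (hg : g₁ + g₂ + g₃ = 1)
    (hb0 : 0 = b₁ • (l₂ • p + x) + b₂ • (l₂ • q + x) + b₃ • (l₂ • r + x))
    (hg0 : 0 = g₁ • p + g₂ • q + g₃ • r) :
    (1 / 3 : ℝ) • (((l₁ + l₂) / 2) • p + x + (((l₁ + l₂) / 2) • q + x) +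
      (((l₁ + l₂) / 2) • r + x)) =
    (2 * l₂ / (l₁ + l₂) * ((1 / 3 - b₂) + ((1 - l₁ / l₂) * g₂ - (1 - l₁ / l₂) / 3) / 2)) •
        (((l₁ + l₂) / 2) • q - ((l₁ + l₂) / 2) • p) +
      (2 * l₂ / (l₁ + l₂) * ((1 / 3 - b₃) + ((1 - l₁ / l₂) * g₃ - (1 - l₁ / l₂) / 3) / 2)) •
        (((l₁ + l₂) / 2) • r - ((l₁ + l₂) / 2) • p) := by
  obtain rfl : b₁ = 1 - b₂ - b₃ := by linarith
  obtain rfl : g₁ = 1 - g₂ - g₃ := by linarith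
  have key : ∀ i, (1 / 3 : ℝ) * ((l₁ + l₂) / 2 * p i + x i + ((l₁ + l₂) / 2 * q i + x i) +
      ((l₁ + l₂) / 2 * r i + x i)) =
    2 * l₂ / (l₁ + l₂) * ((1 / 3 - b₂) + ((1 - l₁ / l₂) * g₂ - (1 - l₁ / l₂) / 3) / 2) *
        ((l₁ + l₂) / 2 * q i - (l₁ + l₂) / 2 * p i) +
      2 * l₂ / (l₁ + l₂) * ((1 / 3 - b₃) + ((1 - l₁ / l₂) * g₃ - (1 - l₁ / l₂) / 3) / 2) *
        ((l₁ + l₂) / 2 * r i - (l₁ + l₂) / 2 * p i) := by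
    intro i
    have e₁ := congrArg (fun v : Plane => v i) hb0
    have e₂ := congrArg (fun v : Plane => v i) hg0
    simp only [PiLp.add_apply, PiLp.smul_apply, smul_eq_mul, PiLp.zero_apply] at e₁ e₂
    have : l₁ + l₂ ≠ 0 := by positivity
    field_simp
    linear_combination (-6) * e₁ + 3 * (l₂ - l₁) * e₂
  exact plane_ext (key 0) (key 1)

theorem centre_dist_le {K : Set Plane} (hK : Convex ℝ K) (h0 : (0 : Plane) ∈ interior K) {ε : ℝ}
    (hε : 0 < ε)
    (hvol : volume K * volume (polarBody K) ≤ ENNReal.ofReal ((1 + ε) * (27 / 4)))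
    (T : Affine.Triangle ℝ Plane) (x : Plane) {lam₁ lam₂ : ℝ} (h₁ : 0 < lam₁) (h₂ : 0 < lam₂)
    (hsub₁ : lam₁ • T.closedInterior + {x} ⊆ K) (hsub₂ : K ⊆ lam₂ • T.closedInterior + {x})
    (hle : lam₂ / lam₁ ≤ 1 + 900 * ε) (hlt : 1 + 900 * ε < 4) {N : Plane → ℝ}
    (hN : IsUnitRegularNorm (fun i => ((lam₁ + lam₂) / 2) • T.points i) N) :
    N (Finset.univ.centroid ℝ (fun i => ((lam₁ + lam₂) / 2) • T.points i + x) - 0) ≤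
      917 * √ε := by
  set p := T.points 0 with hp
  set q := T.points 1 with hq
  set r := T.points 2 with hr
  have hT : area p q r ≠ 0 := area_ne_zero_of_affineIndependent T.independent
  have hT₂ : area q r p ≠ 0 := by rwa [area_rotate]
  have hT₃ : area r p q ≠ 0 := by rwa [area_rotate]
  have hmem : ∀ i, lam₁ • T.points i + x ∈ K := fun i => hsub₁
    (Set.add_mem_add (Set.smul_mem_smul_set (T.point_mem_closedInterior i)) rfl)
  have harea : ∀ l : ℝ, area (l • p + x) (l • q + x) (l • r + x) = l ^ 2 * area p q r := by
    intro l
    simp only [area, cross, PiLp.sub_apply, PiLp.add_apply, PiLp.smul_apply, smul_eq_mul]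
    ring
  have hbary : ∀ y ∈ K, ∃ t₀ t₁ t₂ : ℝ, 0 ≤ t₀ ∧ 0 ≤ t₁ ∧ 0 ≤ t₂ ∧ t₀ + t₁ + t₂ = 1 ∧
      y = lam₂ • (t₀ • p + t₁ • q + t₂ • r) + x := by
    intro y hy
    obtain ⟨_, ⟨z, hz, rfl⟩, _, rfl, rfl⟩ := Set.mem_add.1 (hsub₂ hy)
    obtain ⟨t₀, t₁, t₂, g₀, g₁, g₂, hs, rfl⟩ := (mem_closedInterior_iff T z).1 hz
    exact ⟨t₀, t₁, t₂, g₀, g₁, g₂, hs, rfl⟩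
  set P := lam₂ • p + x with hP
  set Q := lam₂ • q + x with hQ
  set R := lam₂ • r + x with hR
  have hPQR : area P Q R ≠ 0 := by
    rw [harea]
    positivity
  have hQRP : area Q R P ≠ 0 := by rwa [area_rotate]
  have hRPQ : area R P Q ≠ 0 := by rwa [area_rotate]
  have hcombo : ∀ t₀ t₁ t₂ : ℝ, t₀ + t₁ + t₂ = 1 →
      lam₂ • (t₀ • p + t₁ • q + t₂ • r) + x = t₀ • P + t₁ • Q + t₂ • R := by
    intro t₀ t₁ t₂ hs
    obtain rfl : t₀ = 1 - t₁ - t₂ := by linarith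
    rw [hP, hQ, hR]
    module
  have nn₁ : ∀ y ∈ K, 0 ≤ bary P Q R y := by
    intro y hy
    obtain ⟨t₀, t₁, t₂, g₀, g₁, g₂, hs, rfl⟩ := hbary y hy
    rw [hcombo _ _ _ hs, bary_combo hPQR hs]
    exact g₀
  have nn₂ : ∀ y ∈ K, 0 ≤ bary Q R P y := by
    intro y hy
    obtain ⟨t₀, t₁, t₂, g₀, g₁, g₂, hs, rfl⟩ := hbary y hy
    rw [hcombo _ _ _ hs, show t₀ • P + t₁ • Q + t₂ • R = t₁ • Q + t₂ • R + t₀ • P by abel,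
      bary_combo hQRP (by linarith)]
    exact g₁
  have nn₃ : ∀ y ∈ K, 0 ≤ bary R P Q y := by
    intro y hy
    obtain ⟨t₀, t₁, t₂, g₀, g₁, g₂, hs, rfl⟩ := hbary y hy
    rw [hcombo _ _ _ hs, show t₀ • P + t₁ • Q + t₂ • R = t₂ • R + t₀ • P + t₁ • Q by abel,
      bary_combo hRPQ (by linarith)]
    exact g₂
  obtain ⟨b₁, b₂, b₃, hprod⟩ := area_le_of_between (ρ := lam₁ / lam₂) hK h0
    (by positivity) hvol (hmem 0) (hmem 1) (hmem 2) hPQR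
    (by rw [harea, harea]; field_simp) nn₁ nn₂ nn₃
  have hbsum := bary_sum hPQR 0
  have hb0 := bary_combination hPQR 0
  have hγsum := bary_sum hT 0
  have hγ0 := bary_combination hT 0
  have hscaled : ∀ i, ∃ t₀ t₁ t₂ : ℝ, 0 ≤ t₀ ∧ 0 ≤ t₁ ∧ 0 ≤ t₂ ∧ t₀ + t₁ + t₂ = 1 ∧
      (lam₁ / lam₂) • T.points i = t₀ • p + t₁ • q + t₂ • r := by
    intro i
    obtain ⟨t₀, t₁, t₂, g₀, g₁, g₂, hs, e⟩ := hbary _ (hmem i)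
    refine ⟨t₀, t₁, t₂, g₀, g₁, g₂, hs, ?_⟩
    rw [div_eq_inv_mul, mul_smul, add_right_cancel e, smul_smul, inv_mul_cancel₀ h₂.ne', one_smul]
  -- The coordinate is affine and vanishes at b. As (λ₁/λ₂)T lies in T, this makes the three numbers
  -- (1 - λ₁/λ₂) · `bary` at o nonnegative, even if o is outside T.
  have hlin : ∀ a b c : Plane, ∀ l : ℝ, bary a b c (l • b) = (1 - l) * bary a b c 0 := by
    intro a b c l
    simp only [bary]
    rw [← mul_div_assoc]
    congr 1
    simp only [area, cross, PiLp.sub_apply, PiLp.smul_apply, PiLp.zero_apply, smul_eq_mul]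
    ring
  have g₁ : 0 ≤ (1 - lam₁ / lam₂) * bary p q r 0 := by
    obtain ⟨t₀, t₁, t₂, g₀, g₁, g₂, hs, e⟩ := hscaled 1
    rw [← hlin, hq, e, bary_combo hT hs]
    exact g₀
  have g₂ : 0 ≤ (1 - lam₁ / lam₂) * bary q r p 0 := by
    obtain ⟨t₀, t₁, t₂, g₀, g₁, g₂, hs, e⟩ := hscaled 2
    rw [← hlin, hr, e, show t₀ • p + t₁ • q + t₂ • r = t₁ • q + t₂ • r + t₀ • p by abel,
      bary_combo hT₂ (by linarith)]
    exact g₁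
  have g₃ : 0 ≤ (1 - lam₁ / lam₂) * bary r p q 0 := by
    obtain ⟨t₀, t₁, t₂, g₀, g₁, g₂, hs, e⟩ := hscaled 0
    rw [← hlin, hp, e, show t₀ • p + t₁ • q + t₂ • r = t₂ • r + t₀ • p + t₁ • q by abel,
      bary_combo hT₃ (by linarith)]
    exact g₂
  have hρ : 0 < lam₁ / lam₂ := by positivity
  have hρ' : 1 / (lam₁ / lam₂) ≤ 1 + 900 * ε := by rwa [one_div_div]
  have hS := variance_le b₁ b₂ b₃ hbsum hρ hε hlt hρ' hprod
  have hgsum : (1 - lam₁ / lam₂) * bary p q r 0 + (1 - lam₁ / lam₂) * bary q r p 0 +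
      (1 - lam₁ / lam₂) * bary r p q 0 = 1 - lam₁ / lam₂ := by
    rw [← mul_add, ← mul_add, hγsum, mul_one]
  have hdev : 1 - lam₁ / lam₂ ≤ 900 * ε := by
    rw [div_le_iff₀ hρ] at hρ'
    have : lam₁ / lam₂ ≤ 1 := by linarith
    nlinarith
  have hκ : 2 * lam₂ / (lam₁ + lam₂) ≤ 2 := by
    rw [div_le_iff₀ (by positivity)]
    linarith
  have hquad := quadraticForm_le g₁ g₂ g₃ hgsum hbsum (by positivity) hκ hρ.le hdev hS rfl rfl
  have e := centre_eq h₁ h₂ hbsum hγsum hb0 hγ0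
  rw [sub_zero, centroid_fin_three, e, hN.sq]
  calc _ ≤ √(917 ^ 2 * ε) := Real.sqrt_le_sqrt hquad
    _ = 917 * √ε := by
      rw [Real.sqrt_mul (by positivity), Real.sqrt_sq (by norm_num)]

theorem theorem2 (K : Set Plane) (hconv : Convex ℝ K) (hcomp : IsCompact K)
    (h0 : (0 : Plane) ∈ interior K) (ε : ℝ) (hε : 0 < ε)
    (hvol : volume K * volume (polarBody K) ≤ ENNReal.ofReal ((1 + ε) * (27 / 4))) :
    (∀ T : Affine.Triangle ℝ Plane, banachMazurDist K T.closedInterior ≤ 1 + 900 * ε) ∧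
    ∀ (T : Affine.Triangle ℝ Plane) (x : Plane) (lam₁ lam₂ : ℝ), 0 < lam₁ → 0 < lam₂ →
      lam₁ • T.closedInterior + {x} ⊆ K → K ⊆ lam₂ • T.closedInterior + {x} →
      lam₂ / lam₁ ≤ 1 + 900 * ε → 1 + 900 * ε < 4 →
      ∀ N : Plane → ℝ, IsUnitRegularNorm (fun i => ((lam₁ + lam₂) / 2) • T.points i) N →
        N (Finset.univ.centroid ℝ (fun i => ((lam₁ + lam₂) / 2) • T.points i + x) - 0) ≤
          917 * √ε :=
  ⟨banachMazurDist_triangle_le hconv hcomp h0 hε hvol,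
    fun T x _ _ h₁ h₂ hsub₁ hsub₂ hle hlt _ hN =>
      centre_dist_le hconv h0 hε hvol T x h₁ h₂ hsub₁ hsub₂ hle hlt hN⟩
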